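/- Let $\mathcal O$ be Kleene's system of ordinal notations, with order $<_{\mathcal O}$ and $|a|_{\mathcal O}$ the ordinal denoted by $a\in\mathcal O$, and for $a\in\mathcal O$ let $H(a)\subseteq\mathbb N$ be defined by $H(1)=\emptyset$, $H(2^a)=H(a)'$ (Turing jump) and $H(3\cdot5^e)=\{\langle u,v\rangle: u<_{\mathcal O}3\cdot 5^e,\ v\in H(u)\}$. For $0<\alpha<\omega_1^{\mathrm{CK}}$, a number $e=\langle i,a\rangle$ is a $\Sigma^0_\alpha$ index of $A\subseteq\mathbb N$ if $a\in\mathcal O$, $1+|a|_{\mathcal O}=\alpha$ and $A=W_i^{H(a)}$; $A$ is $\Sigma^0_\alpha$ if it has a $\Sigma^0_\alpha$ index. Fix a computable enumeration $(q_n)_{n\in\mathbb N}$ of $\mathbb Q$; the right (left) Dedekind cut of $r\in\mathbb R$ is the set of rationals $q>r$ (respectively $q<r$), identified with the set of those $n$ for which $q_n$ belongs to it. Let $L_M$ be the language of metric spaces, whose only symbol is the metric $\underline d$. Infinitary $L_M$-formulas take values in $[0,1]$ and are built from the atomic formulas $\underline d(x_i,x_j)$ by the connectives $\neg$ ($t\mapsto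 1-t$), $\tfrac12$ ($t\mapsto t/2$) and truncated subtraction, the quantifiers $\inf_x$ and $\sup_x$, and countable disjunctions (interpreted as infima) and conjunctions (interpreted as suprema). The computable $\Sigma_0$ and $\Pi_0$ formulas are the finitary quantifier-free ones. For $0<\alpha<\omega_1^{\mathrm{CK}}$, a computable $\Sigma_\alpha$ formula is a disjunction of a c.e. family of formulas $\inf_{\bar u}\psi$, each $\psi$ a computable $\Pi_\beta$ formula for some $\beta<\alpha$ (which may vary with the disjunct), the free variables of all disjuncts lying in one finite tuple; a computable $\Pi_\alpha$ formula is a conjunction of a c.e. family of formulas $\sup_{\bar u}\psi$ with each $\psi$ computable $\Sigma_\beta$ for some $\beta<\alpha$, under the same condition. A code of such a formula consists of the symbol $\Sigma$ or $\Pi$, a notation $a\in\mathcal O$ of $\alpha$, a finite tuple containing the free variables, and an index of the c.e. set of pairs (code of $\bar u$, code of $\psi$), where the codes of the formulas $\psi$ carry notations $b<_{\mathcal O}a$; if $\alpha=0$, a Gödel number of the formula takes the place of the index. An $L_M$-sentence $\Phi$ is a numeral for $r$ if $\Phi^{\mathcal M}=r$ for every $L_M$-structure $\mathcal M$, i.e.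 every nonempty metric space of diameter at most $1$. Theorem. Suppose $0<\alpha<\omega_1^{\mathrm{CK}}$, and let $r\in[0,1]$. (1) If the right Dedekind cut of $r$ is $\Sigma^0_\alpha$, then $r$ has a computable $\Sigma_\alpha$ $L_M$-numeral $\Phi$. Furthermore, a code of such a $\Phi$ can be computed from a $\Sigma^0_\alpha$ index of the right Dedekind cut of $r$. (2) If the left Dedekind cut of $r$ is $\Sigma^0_\alpha$, then $r$ has a computable $\Pi_\alpha$ $L_M$-numeral $\Phi$. Furthermore, a code of such a $\Phi$ can be computed from a $\Sigma^0_\alpha$ index of the left Dedekind cut of $r$. The computations are uniform: in each of (1) and (2) there is a single computable function $f:\mathbb N\to\mathbb N$ such that, for all $\alpha$ and $r$ as above and every $\Sigma^0_\alpha$ index $e$ of the cut in question, $f(e)$ is a code of a numeral for $r$ as stated. -/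

import Mathlib

universe u

namespace HypNum

open Encodable Nat.Partrec

/-! ### Computability: indices, relative enumerability, jump -/

/-- The `e`-th partial computable function `φ_e`. -/
def phi (e : ℕ) : ℕ →. ℕ := (Denumerable.ofNat Code e).eval

/-- The `e`-th computably enumerable set `W_e = dom φ_e`. -/
def W (e : ℕ) : Set ℕ := {n | (phi e n).Dom}

/-- The finite binary string `σ` is an initial segment of the characteristic function of `X`. -/
def IsInitSeg (σ : List Bool) (X : Set ℕ) : Prop :=
  ∀ i (h : i < σ.length), σ[i] = true ↔ i ∈ X

/-- The `e`-th set `W_e^X` that is computably enumerable relative to `X`. The Turing functional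
with index `e` is given by its c.e. set of halting axioms: it accepts `n` relative to `X` when it
accepts `n` using only a finite initial segment of the oracle. -/
def WRel (e : ℕ) (X : Set ℕ) : Set ℕ :=
  {n | ∃ σ : List Bool, IsInitSeg σ X ∧ Nat.pair n (encode σ) ∈ W e}

/-- The Turing jump `X' = {e | e ∈ W_e^X}`. -/
def jump (X : Set ℕ) : Set ℕ := {e | e ∈ WRel e X}

/-! ### Kleene's system of ordinal notations and the `H`-sets -/

/-- `IsNotation a α P`: `a ∈ 𝒪`, `|a|_𝒪 = α`, and `P = {b | b <_𝒪 a}`. -/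
inductive IsNotation : ℕ → Ordinal.{0} → Set ℕ → Prop
  | one : IsNotation 1 0 ∅
  | succ (a : ℕ) (α : Ordinal.{0}) (P : Set ℕ) :
      IsNotation a α P → IsNotation (2 ^ a) (Order.succ α) (insert a P)
  | lim (e : ℕ) (f : ℕ → ℕ) (α : ℕ → Ordinal.{0}) (P : ℕ → Set ℕ) :
      (∀ n, f n ∈ phi e n) → (∀ n, IsNotation (f n) (α n) (P n)) →
      (∀ n, f n ∈ P (n + 1)) →
      IsNotation (3 * 5 ^ e) (⨆ n, α n) (⋃ n, P n)

/-- `a ∈ 𝒪`. -/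
def InO (a : ℕ) : Prop := ∃ α P, IsNotation a α P

/-- `a ∈ 𝒪` and `|a|_𝒪 = α`. -/
def Denotes (a : ℕ) (α : Ordinal.{0}) : Prop := ∃ P, IsNotation a α P

/-- `a ∈ 𝒪` and `b <_𝒪 a`. -/
def LtO (b a : ℕ) : Prop := ∃ α P, IsNotation a α P ∧ b ∈ P

/-- The Church–Kleene ordinal: the least ordinal without a notation. -/
noncomputable def omega1CK : Ordinal.{0} := sInf {α | ∀ a, ¬ Denotes a α}

/-- `IsH a X`: `a ∈ 𝒪` and `X = H(a)`. -/
inductive IsH : ℕ → Set ℕ → Prop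
  | one : IsH 1 ∅
  | succ (a : ℕ) (X : Set ℕ) : IsH a X → IsH (2 ^ a) (jump X)
  | lim (e : ℕ) (Y : ℕ → Set ℕ) : InO (3 * 5 ^ e) →
      (∀ u, LtO u (3 * 5 ^ e) → IsH u (Y u)) →
      IsH (3 * 5 ^ e)
        {m | LtO m.unpair.1 (3 * 5 ^ e) ∧ m.unpair.2 ∈ Y m.unpair.1}

/-- `e = ⟨i, a⟩` is a `Σ⁰_α` index of `A` (for `α > 0`): `a ∈ 𝒪` and `A = W_i^{H(a)}`, where
`1 + |a| = α`. That is, `|a| = α - 1` for finite `α` and `|a| = α` for infinite `α`. -/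
def IsSigmaIndex (α : Ordinal.{0}) (e : ℕ) (A : Set ℕ) : Prop :=
  ∃ β X, Denotes e.unpair.2 β ∧ 1 + β = α ∧ IsH e.unpair.2 X ∧ A = WRel e.unpair.1 X

/-- `A ⊆ ℕ` is `Σ⁰_α` (for `α > 0`). -/
def IsSigmaSet (α : Ordinal.{0}) (A : Set ℕ) : Prop := ∃ e, IsSigmaIndex α e A

/-- A computable enumeration `(q_n)` of `ℚ`: if `n = ⟨x, ⟨y, z⟩⟩` then `q_n = (x - y)/(z + 1)`. -/
def ratEnum (n : ℕ) : ℚ :=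
  ((n.unpair.1 : ℚ) - (n.unpair.2.unpair.1 : ℚ)) / ((n.unpair.2.unpair.2 : ℚ) + 1)

/-- The right Dedekind cut of `r`, as a set of indices of rational numbers. -/
def rightCut (r : ℝ) : Set ℕ := {n | r < (ratEnum n : ℝ)}

/-- The left Dedekind cut of `r`, as a set of indices of rational numbers. -/
def leftCut (r : ℝ) : Set ℕ := {n | (ratEnum n : ℝ) < r}

/-! ### Infinitary continuous logic over the language of metric spaces -/

/-- Infinitary formulas in the language `L_M` whose only nonlogical symbol is the metric, with
variables `x_0, x_1, …`, the connectives `¬`, `½`, `∸`, the quantifiers `inf_x`, `sup_x`, and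
countable disjunctions and conjunctions. -/
inductive Formula : Type
  | dist (i j : ℕ) : Formula
  | neg (φ : Formula) : Formula
  | half (φ : Formula) : Formula
  | monus (φ ψ : Formula) : Formula
  | inf (i : ℕ) (φ : Formula) : Formula
  | sup (i : ℕ) (φ : Formula) : Formula
  | disj (S : Set ℕ) (φ : S → Formula) : Formula
  | conj (S : Set ℕ) (φ : S → Formula) : Formula

namespace Formula

/-- The set of free variables. -/
def freeVars : Formula → Set ℕ
  | dist i j => {i, j}
  | neg φ => φ.freeVars
  | half φ => φ.freeVars
  | monus φ ψ => φ.freeVars ∪ ψ.freeVars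
  | inf i φ => φ.freeVars \ {i}
  | sup i φ => φ.freeVars \ {i}
  | disj _ φ => ⋃ k, (φ k).freeVars
  | conj _ φ => ⋃ k, (φ k).freeVars

/-- `inf_{u_1} ⋯ inf_{u_k} φ`. -/
def infs (us : List ℕ) (φ : Formula) : Formula := us.foldr inf φ

/-- `sup_{u_1} ⋯ sup_{u_k} φ`. -/
def sups (us : List ℕ) (φ : Formula) : Formula := us.foldr sup φ

/-- The truth value of a formula in a metric space of diameter at most `1`, under an assignment.
Truth values lie in the complete lattice `[0,1]`; disjunction is infimum and conjunction is
supremum, so the empty disjunction has value `1` and the empty conjunction has value `0`. -/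
noncomputable def eval {M : Type u} [MetricSpace M] (hM : ∀ x y : M, Dist.dist x y ≤ 1) :
    Formula → (ℕ → M) → unitInterval
  | dist i j, v => ⟨Dist.dist (v i) (v j), dist_nonneg, hM _ _⟩
  | neg φ, v => unitInterval.symm (φ.eval hM v)
  | half φ, v => ⟨(φ.eval hM v : ℝ) / 2, by
      have h := (φ.eval hM v).2
      exact ⟨by linarith [h.1], by linarith [h.2]⟩⟩
  | monus φ ψ, v => ⟨max ((φ.eval hM v : ℝ) - (ψ.eval hM v : ℝ)) 0, by
      have h := (φ.eval hM v).2
      have h' := (ψ.eval hM v).2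
      exact ⟨le_max_right _ _, max_le (by linarith [h.2, h'.1]) zero_le_one⟩⟩
  | inf i φ, v => ⨅ m : M, φ.eval hM (Function.update v i m)
  | sup i φ, v => ⨆ m : M, φ.eval hM (Function.update v i m)
  | disj _ φ, v => ⨅ k, (φ k).eval hM v
  | conj _ φ, v => ⨆ k, (φ k).eval hM v

/-- `φ` is a numeral for `r`: a sentence whose value is `r` in every `L_M`-structure, that is, in
every nonempty metric space of diameter at most `1`. -/
def IsNumeral (φ : Formula) (r : ℝ) : Prop :=
  φ.freeVars = ∅ ∧
    ∀ (M : Type u) [MetricSpace M] [Nonempty M] (hM : ∀ x y : M, Dist.dist x y ≤ 1) (v : ℕ → M),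
      (φ.eval hM v : ℝ) = r

end Formula

/-! ### Computable infinitary formulas and their codes -/

/-- Gödel numbers of the finitary quantifier-free formulas. -/
inductive IsQFCode : ℕ → Formula → Prop
  | dist (i j : ℕ) : IsQFCode (4 * Nat.pair i j) (.dist i j)
  | neg (c : ℕ) (φ : Formula) : IsQFCode c φ → IsQFCode (4 * c + 1) φ.neg
  | half (c : ℕ) (φ : Formula) : IsQFCode c φ → IsQFCode (4 * c + 2) φ.half
  | monus (c d : ℕ) (φ ψ : Formula) : IsQFCode c φ → IsQFCode d ψ →
      IsQFCode (4 * Nat.pair c d + 3) (φ.monus ψ)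

/-- The two kinds of computable infinitary formulas. -/
inductive Kind : Type
  | sigma : Kind
  | pi : Kind

/-- The symbols `Σ` and `Π` as numbers. -/
def Kind.toNat : Kind → ℕ
  | sigma => 0
  | pi => 1

/-- The number `⟨s, a, xs, e⟩`, where `s` is `Σ` or `Π`, `a` is an ordinal notation, `xs` a tuple
of variables and `e` a number. -/
def mkCode (s : Kind) (a : ℕ) (xs : List ℕ) (e : ℕ) : ℕ :=
  Nat.pair s.toNat (Nat.pair a (Nat.pair (encode xs) e))

/-- `IsCode s a xs c φ`: the number `c` is a code of the computable `s_a` formula `φ`, with free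
variables among `xs`. At the notation `1` of the ordinal `0` these are the finitary
quantifier-free formulas. For `a ∈ 𝒪` with `|a| > 0`, a computable `Σ_a` formula is the
disjunction, over a c.e. set `W_e` of pairs `⟨us, j⟩`, of the formulas `inf_{us} ψ`, where `j` is a
code of `ψ`, a computable `Π_b` formula for some `b <_𝒪 a` with free variables among `xs, us`.
Computable `Π_a` formulas are obtained dually. -/
inductive IsCode : Kind → ℕ → List ℕ → ℕ → Formula → Prop
  | qf (s : Kind) (xs : List ℕ) (c : ℕ) (φ : Formula) :
      IsQFCode c φ → φ.freeVars ⊆ {i | i ∈ xs} → IsCode s 1 xs (mkCode s 1 xs c) φ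
  | sigma (a : ℕ) (xs : List ℕ) (e : ℕ)
      (us : W e → List ℕ) (j : W e → ℕ) (b : W e → ℕ) (ys : W e → List ℕ) (ψ : W e → Formula) :
      InO a → a ≠ 1 →
      (∀ k : W e, (k : ℕ) = Nat.pair (encode (us k)) (j k)) →
      (∀ k, LtO (b k) a) → (∀ k, ys k ⊆ xs ++ us k) →
      (∀ k, IsCode .pi (b k) (ys k) (j k) (ψ k)) →
      IsCode .sigma a xs (mkCode .sigma a xs e) (.disj (W e) fun k => (ψ k).infs (us k))
  | pi (a : ℕ) (xs : List ℕ) (e : ℕ)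
      (us : W e → List ℕ) (j : W e → ℕ) (b : W e → ℕ) (ys : W e → List ℕ) (ψ : W e → Formula) :
      InO a → a ≠ 1 →
      (∀ k : W e, (k : ℕ) = Nat.pair (encode (us k)) (j k)) →
      (∀ k, LtO (b k) a) → (∀ k, ys k ⊆ xs ++ us k) →
      (∀ k, IsCode .sigma (b k) (ys k) (j k) (ψ k)) →
      IsCode .pi a xs (mkCode .pi a xs e) (.conj (W e) fun k => (ψ k).sups (us k))

/-- `c` is a code of the computable `Σ_α` formula `φ`. -/
def IsSigmaCode (α : Ordinal.{0}) (c : ℕ) (φ : Formula) : Prop :=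
  ∃ a xs, Denotes a α ∧ IsCode .sigma a xs c φ

/-- `c` is a code of the computable `Π_α` formula `φ`. -/
def IsPiCode (α : Ordinal.{0}) (c : ℕ) (φ : Formula) : Prop :=
  ∃ a xs, Denotes a α ∧ IsCode .pi a xs c φ

/-- `φ` is a computable `Σ_α` formula. -/
def IsComputableSigma (α : Ordinal.{0}) (φ : Formula) : Prop := ∃ c, IsSigmaCode α c φ

/-- `φ` is a computable `Π_α` formula. -/
def IsComputablePi (α : Ordinal.{0}) (φ : Formula) : Prop := ∃ c, IsPiCode α c φ

end HypNum

/-! For a right cut, `r` is the infimum in `[0,1]` of the dyadic numbers `D` with `q_n ≤ D` for some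
`q_n` in the cut. Dyadics are values of quantifier-free formulas built from `d(x_0,x_0) = 0`. So it
suffices to attach to every `D` and every possible verification of `n ∈ W_i^{H(a)}` a `Π` formula of
level below `1 + |a|` that has value `D` if the oracle facts assumed by the verification are true,
and value `1` otherwise; the disjunction of these formulas is the numeral. Left cuts are dual, with
suprema and the default value `0`.

The oracle facts are unwound. Positive facts about `H(a)` are replaced by the finite computations
that establish them, until only negative facts remain: `m ∉ H(2^b)`, or `u ≮ a` for a limit notation
`a`. A condition is a finite list of such facts. By induction on `a`, every initial segment of
`H(a)` is settled by a true condition of level strictly below `1 + |a|` (`InO.exists_decidesSeg`). A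
condition fails exactly when one of its items is refuted, and a refutation is again a true
condition, of smaller level (`condTrue_iff_forall_child`). Truth therefore alternates along a
well-founded tree, and alternating infima and suprema turn it into formulas with two possible values
`X ≤ Y` (`IsNodeCoding.codesValue`).

For effectiveness, `𝒪` is not c.e., but below each notation `<_𝒪` agrees with one c.e. relation
`Below`. The children of a node can thus be enumerated without knowing that the numbers involved are
notations, and the recursion theorem yields a program that outputs the codes of all child formulas
(`exists_isNodeCoding`). Correctness is proved separately, by induction along `<_𝒪` at genuine
notations. -/

namespace HypNum

open Encodable Nat.Partrec

/-! ### Computably enumerable predicates: closure properties and the recursion theorem -/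

/-- Computably enumerable predicates, as projections of primitive recursive relations. -/
def SigmaOne {α : Type*} [Primcodable α] (p : α → Prop) : Prop :=
  ∃ q : α → ℕ → Prop, PrimrecRel q ∧ ∀ a, p a ↔ ∃ n, q a n

namespace SigmaOne

variable {α : Type*} {β : Type*} [Primcodable α] [Primcodable β]

theorem of_eq {p q : α → Prop} (hp : SigmaOne p) (h : ∀ a, p a ↔ q a) : SigmaOne q :=
  (funext fun a => propext (h a) : p = q) ▸ hp

theorem of_primrecPred {p : α → Prop} (hp : PrimrecPred p) : SigmaOne p :=
  ⟨fun a _ => p a, PrimrecPred.comp hp Primrec.fst, fun a => by simp⟩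

theorem comp {p : β → Prop} (hp : SigmaOne p) {f : α → β} (hf : Primrec f) :
    SigmaOne fun a => p (f a) := by
  obtain ⟨q, hq, h⟩ := hp
  exact ⟨fun a n => q (f a) n, hq.comp (hf.comp Primrec.fst) Primrec.snd, fun a => h _⟩

theorem and {p q : α → Prop} (hp : SigmaOne p) (hq : SigmaOne q) :
    SigmaOne fun a => p a ∧ q a := by
  obtain ⟨p', hp', h⟩ := hp
  obtain ⟨q', hq', h'⟩ := hq
  have u := Primrec.unpair.comp (Primrec.snd (α := α) (β := ℕ))
  refine ⟨fun a n => p' a n.unpair.1 ∧ q' a n.unpair.2,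
    (hp'.comp Primrec.fst (Primrec.fst.comp u)).and (hq'.comp Primrec.fst (Primrec.snd.comp u)),
    fun a => ?_⟩
  beta_reduce
  rw [h, h']
  constructor
  · rintro ⟨⟨m, hm⟩, n, hn⟩
    exact ⟨Nat.pair m n, by simpa using ⟨hm, hn⟩⟩
  · rintro ⟨n, h1, h2⟩
    exact ⟨⟨_, h1⟩, _, h2⟩

theorem or {p q : α → Prop} (hp : SigmaOne p) (hq : SigmaOne q) :
    SigmaOne fun a => p a ∨ q a := by
  obtain ⟨p', hp', h⟩ := hp
  obtain ⟨q', hq', h'⟩ := hq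
  refine ⟨fun a n => p' a n ∨ q' a n, PrimrecPred.or hp' hq', fun a => ?_⟩
  beta_reduce
  rw [h, h', exists_or]

theorem exists_snd {p : α × β → Prop} (hp : SigmaOne p) : SigmaOne fun a => ∃ b, p (a, b) := by
  classical
  obtain ⟨q, hq, h⟩ := hp
  have u := Primrec.unpair.comp (Primrec.snd (α := α) (β := ℕ))
  have hq' : PrimrecPred fun x : (α × ℕ) × β => q (x.1.1, x.2) x.1.2.unpair.2 :=
    hq.comp ((Primrec.fst.comp Primrec.fst).pair Primrec.snd)
      (Primrec.snd.comp (u.comp Primrec.fst))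
  have hd := hq'.decide
  have hopt : Primrec fun x : α × ℕ =>
      ((decode (α := β) x.2.unpair.1).map fun b => decide (q (x.1, b) x.2.unpair.2)).getD false :=
    Primrec.option_getD.comp
      (Primrec.option_map (Primrec.decode.comp (Primrec.fst.comp u)) hd) (Primrec.const false)
  -- A number that decodes to no element of `β` gets the value `false`, so it never counts as a
  -- witness.
  refine ⟨fun a n => ((decode (α := β) n.unpair.1).map
    fun b => decide (q (a, b) n.unpair.2)).getD false = true, ?_, fun a => ?_⟩
  · exact Primrec.primrecPred (by simpa using hopt)
  · constructor
    · rintro ⟨b, hb⟩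
      obtain ⟨n, hn⟩ := (h _).1 hb
      exact ⟨Nat.pair (encode b) n, by simpa using hn⟩
    · rintro ⟨n, hn⟩
      cases hb : decode (α := β) n.unpair.1 with
      | none => simp [hb] at hn
      | some b =>
        refine ⟨b, (h _).2 ⟨n.unpair.2, ?_⟩⟩
        simpa [hb] using hn

/-- Finitely many witnesses have a common bound, so the unbounded search can be moved in front of
the quantifier over the list. -/
theorem forall_mem_list {p : α × β → Prop} (hp : SigmaOne p) {l : α → List β} (hl : Primrec l) :
    SigmaOne fun a => ∀ b ∈ l a, p (a, b) := by
  obtain ⟨q, hq, h⟩ := hp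
  have h1 : PrimrecRel fun (n : ℕ) (x : α × β) => ∃ m < n, q x m :=
    PrimrecPred.of_eq (p := fun y : ℕ × (α × β) => ∃ m ∈ List.range y.1, q y.2 m)
      ((PrimrecRel.exists_mem_list (R := fun (m : ℕ) (x : α × β) => q x m)
        (hq.comp Primrec.snd Primrec.fst)).comp (Primrec.list_range.comp Primrec.fst) Primrec.snd)
      fun y => by simp
  have h2 : PrimrecRel fun (L : List β) (x : α × ℕ) => ∀ b ∈ L, ∃ m < x.2, q (x.1, b) m :=
    PrimrecRel.forall_mem_list (R := fun b (x : α × ℕ) => ∃ m < x.2, q (x.1, b) m)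
      (h1.comp (Primrec.snd.comp Primrec.snd)
        ((Primrec.fst.comp Primrec.snd).pair Primrec.fst))
  refine ⟨fun a n => ∀ b ∈ l a, ∃ m < n, q (a, b) m,
    h2.comp (hl.comp Primrec.fst) Primrec.id, fun a => ?_⟩
  constructor
  · intro H
    have key : ∀ L : List β, (∀ b ∈ L, p (a, b)) → ∃ n, ∀ b ∈ L, ∃ m < n, q (a, b) m := by
      intro L
      induction L with
      | nil => exact fun _ => ⟨0, by simp⟩
      | cons b L ih =>
        intro hL
        obtain ⟨n, hn⟩ := ih fun b hb => hL b (by simp [hb])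
        obtain ⟨m, hm⟩ := (h _).1 (hL b (by simp))
        refine ⟨max n (m + 1), fun b' hb' => ?_⟩
        rcases List.mem_cons.1 hb' with rfl | hb'
        · exact ⟨m, by omega, hm⟩
        · obtain ⟨k, hk, hk'⟩ := hn b' hb'
          exact ⟨k, by omega, hk'⟩
    exact key _ H
  · rintro ⟨n, hn⟩ b hb
    obtain ⟨m, -, hm⟩ := hn b hb
    exact (h _).2 ⟨m, hm⟩

theorem mem_eval : SigmaOne fun x : (Code × ℕ) × ℕ => x.2 ∈ x.1.1.eval x.1.2 := by
  refine ⟨fun x n => Code.evaln n x.1.1 x.1.2 = some x.2, ?_, fun x => Code.evaln_complete⟩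
  refine PrimrecRel.comp Primrec.eq ?_ ?_
  · have f1 := Primrec.fst.comp (Primrec.fst (α := (Code × ℕ) × ℕ) (β := ℕ))
    exact Code.primrec_evaln.comp
      ((Primrec.snd.pair (Primrec.fst.comp f1)).pair (Primrec.snd.comp f1))
  · exact Primrec.option_some.comp (Primrec.snd.comp Primrec.fst)

theorem exists_partrec {p : α → Prop} (hp : SigmaOne p) :
    ∃ f : α →. ℕ, Partrec f ∧ ∀ a, (f a).Dom ↔ p a := by
  classical
  obtain ⟨q, hq, h⟩ := hp
  refine ⟨fun a => Nat.rfind fun n => Part.some (decide (q a n)), ?_, fun a => ?_⟩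
  · exact Partrec.rfind (hq.decide.to_comp.partrec.to₂)
  · rw [h]
    exact Nat.rfind_dom.trans (by simp)

/-- Kleene's recursion theorem for computably enumerable predicates. -/
theorem fixed_point {p : Code × ℕ → Prop} (hp : SigmaOne p) :
    ∃ c : Code, ∀ n, (c.eval n).Dom ↔ p (c, n) := by
  obtain ⟨f, hf, h⟩ := hp.exists_partrec
  obtain ⟨c, hc⟩ := Code.fixed_point₂ (f := fun c n => f (c, n)) hf
  exact ⟨c, fun n => by rw [hc]; exact h _⟩

end SigmaOne

/-- The membership relation of the sets `W_e`. -/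
theorem sigmaOne_mem_W : SigmaOne fun x : ℕ × ℕ => x.2 ∈ W x.1 := by
  have := (SigmaOne.mem_eval.comp (f := fun x : (ℕ × ℕ) × ℕ =>
    (((Denumerable.ofNat Code x.1.1, x.1.2), x.2) : (Code × ℕ) × ℕ))
    ((((Primrec.ofNat Code).comp (Primrec.fst.comp Primrec.fst)).pair
      (Primrec.snd.comp Primrec.fst)).pair Primrec.snd)).exists_snd
  refine this.of_eq fun x => ?_
  exact (Part.dom_iff_mem (o := phi x.1 x.2)).symm

theorem sigmaOne_mem_phi : SigmaOne fun x : (ℕ × ℕ) × ℕ => x.2 ∈ phi x.1.1 x.1.2 :=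
  SigmaOne.mem_eval.comp (f := fun x : (ℕ × ℕ) × ℕ =>
    (((Denumerable.ofNat Code x.1.1, x.1.2), x.2) : (Code × ℕ) × ℕ))
    ((((Primrec.ofNat Code).comp (Primrec.fst.comp Primrec.fst)).pair
      (Primrec.snd.comp Primrec.fst)).pair Primrec.snd)

/-- The parameter theorem for computably enumerable sets. -/
theorem SigmaOne.exists_index {p : ℕ × ℕ → Prop} (hp : SigmaOne p) :
    ∃ f : ℕ → ℕ, Primrec f ∧ ∀ e n, n ∈ W (f e) ↔ p (e, n) := by
  -- Self-reference plays no role here: the predicate ignores its code argument, and currying the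
  -- resulting program gives the s-m-n function.
  obtain ⟨c, hc⟩ := SigmaOne.fixed_point (hp.comp (Primrec.unpair.comp Primrec.snd))
  refine ⟨fun e => encode (c.curry e),
    Primrec.encode.comp (Code.primrec₂_curry.comp (Primrec.const c) Primrec.id), fun e n => ?_⟩
  simp [W, phi, Code.eval_curry, hc]

-- Automation for primitive recursive functions

attribute [fun_prop] Primrec
attribute [fun_prop] Primrec.id Primrec.const Primrec.comp Primrec.fst Primrec.snd Primrec.pair

section PrimrecFunctions

variable {α β γ : Type*} [Primcodable α] [Primcodable β] [Primcodable γ]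

@[fun_prop]
theorem primrec_fst {f : α → β × γ} (hf : Primrec f) : Primrec fun a => (f a).1 :=
  Primrec.fst.comp hf

@[fun_prop]
theorem primrec_snd {f : α → β × γ} (hf : Primrec f) : Primrec fun a => (f a).2 :=
  Primrec.snd.comp hf

@[fun_prop]
theorem primrec_unpair {f : α → ℕ} (hf : Primrec f) : Primrec fun a => (f a).unpair :=
  Primrec.unpair.comp hf

@[fun_prop]
theorem primrec_natPair {f g : α → ℕ} (hf : Primrec f) (hg : Primrec g) :
    Primrec fun a => Nat.pair (f a) (g a) :=
  Primrec₂.natPair.comp hf hg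

@[fun_prop]
theorem primrec_add {f g : α → ℕ} (hf : Primrec f) (hg : Primrec g) :
    Primrec fun a => f a + g a :=
  Primrec.nat_add.comp hf hg

@[fun_prop]
theorem primrec_mul {f g : α → ℕ} (hf : Primrec f) (hg : Primrec g) :
    Primrec fun a => f a * g a :=
  Primrec.nat_mul.comp hf hg

@[fun_prop]
theorem primrec_pow {f g : α → ℕ} (hf : Primrec f) (hg : Primrec g) :
    Primrec fun a => f a ^ g a :=
  (Primrec₂.unpaired'.1 Nat.Primrec.pow).comp hf hg

@[fun_prop]
theorem primrec_encode {f : α → β} (hf : Primrec f) : Primrec fun a => encode (f a) :=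
  Primrec.encode.comp hf

@[fun_prop]
theorem primrec_not {f : α → Bool} (hf : Primrec f) : Primrec fun a => !f a :=
  Primrec.not.comp hf

@[fun_prop]
theorem primrec_curry {f : α → Code} {g : α → ℕ} (hf : Primrec f) (hg : Primrec g) :
    Primrec fun a => (f a).curry (g a) :=
  Code.primrec₂_curry.comp hf hg

@[fun_prop]
theorem primrec_cons {f : α → β} {g : α → List β} (hf : Primrec f) (hg : Primrec g) :
    Primrec fun a => f a :: g a :=
  Primrec.list_cons.comp hf hg

@[fun_prop]
theorem primrec_length {f : α → List β} (hf : Primrec f) : Primrec fun a => (f a).length :=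
  Primrec.list_length.comp hf

@[fun_prop]
theorem primrec_some {f : α → β} (hf : Primrec f) : Primrec fun a => some (f a) :=
  Primrec.option_some.comp hf

@[fun_prop]
theorem primrec_getElem? {f : α → List β} {g : α → ℕ} (hf : Primrec f) (hg : Primrec g) :
    Primrec fun a => (f a)[g a]? :=
  Primrec.list_getElem?.comp hf hg

theorem primrecRel_mem : PrimrecRel fun (b : β) (l : List β) => b ∈ l := by
  refine PrimrecPred.of_eq (p := fun x : β × List β => ∃ c ∈ x.2, c = x.1) ?_ fun x => by simp
  exact (PrimrecRel.exists_mem_list (R := fun c b : β => c = b) Primrec.eq).comp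
    Primrec.snd Primrec.fst

end PrimrecFunctions

namespace SigmaOne

variable {α β : Type*} [Primcodable α] [Primcodable β]

theorem eq {f g : α → β} (hf : Primrec f) (hg : Primrec g) : SigmaOne fun a => f a = g a :=
  of_primrecPred (Primrec.eq.comp hf hg)

theorem ne {f g : α → β} (hf : Primrec f) (hg : Primrec g) : SigmaOne fun a => f a ≠ g a :=
  of_primrecPred (PrimrecPred.not (Primrec.eq.comp hf hg))

theorem lt {f g : α → ℕ} (hf : Primrec f) (hg : Primrec g) : SigmaOne fun a => f a < g a :=
  of_primrecPred (Primrec.nat_lt.comp hf hg)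

theorem le {f g : α → ℕ} (hf : Primrec f) (hg : Primrec g) : SigmaOne fun a => f a ≤ g a :=
  of_primrecPred (Primrec.nat_le.comp hf hg)

theorem mem {f : α → β} {l : α → List β} (hf : Primrec f) (hl : Primrec l) :
    SigmaOne fun a => f a ∈ l a :=
  of_primrecPred (primrecRel_mem.comp hf hl)

theorem mem_W {f g : α → ℕ} (hf : Primrec f) (hg : Primrec g) : SigmaOne fun a => g a ∈ W (f a) :=
  sigmaOne_mem_W.comp (hf.pair hg)

theorem mem_phi {f g h : α → ℕ} (hf : Primrec f) (hg : Primrec g) (hh : Primrec h) :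
    SigmaOne fun a => h a ∈ phi (f a) (g a) :=
  sigmaOne_mem_phi.comp ((hf.pair hg).pair hh)

theorem exists' {p : α → β → Prop} (hp : SigmaOne fun x : α × β => p x.1 x.2) :
    SigmaOne fun a => ∃ b, p a b :=
  hp.exists_snd

theorem forall_mem {l : α → List β} {p : α → β → Prop} (hl : Primrec l)
    (hp : SigmaOne fun x : α × β => p x.1 x.2) : SigmaOne fun a => ∀ b ∈ l a, p a b :=
  hp.forall_mem_list hl

end SigmaOne

/-! ### Sets inductively generated by c.e. rules -/

/-- The set inductively generated by the rules `l ⟹ x` with `R x l`. -/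
inductive Generated {β : Type*} (R : β → List β → Prop) : β → Prop
  | intro (x : β) (l : List β) : R x l → (∀ y ∈ l, Generated R y) → Generated R x

/-- A finite set of ranked elements, each obtained by a rule from elements of smaller rank. -/
def IsDerivation {β : Type*} (R : β → List β → Prop) (d : List (β × ℕ)) : Prop :=
  ∀ z ∈ d, ∃ l, R z.1 l ∧ ∀ y ∈ l, ∃ k, (y, k) ∈ d ∧ k < z.2

/-- A derivation tree is flattened to a finite list of ranked elements. The ranks exclude circular
derivations, and induction on the rank recovers the tree. -/
theorem generated_iff_exists_isDerivation {β : Type*} {R : β → List β → Prop} {x : β} :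
    Generated R x ↔ ∃ d k, (x, k) ∈ d ∧ IsDerivation R d := by
  constructor
  · intro h
    induction h with
    | intro x l hl _ ih =>
      have key : ∀ l' : List β, l' ⊆ l →
          ∃ d, (∀ y ∈ l', ∃ k, (y, k) ∈ d) ∧ IsDerivation R d := by
        intro l'
        induction l' with
        | nil => exact fun _ => ⟨[], by simp, by simp [IsDerivation]⟩
        | cons y l' ih' =>
          intro hs
          obtain ⟨d, hd, hd'⟩ := ih' fun z hz => hs (by simp [hz])
          obtain ⟨d₁, k, hk, hd₁⟩ := ih y (hs (by simp))
          refine ⟨d₁ ++ d, fun z hz => ?_, fun z hz => ?_⟩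
          · rcases List.mem_cons.1 hz with rfl | hz
            · exact ⟨k, by simp [hk]⟩
            · obtain ⟨j, hj⟩ := hd z hz
              exact ⟨j, by simp [hj]⟩
          · rcases List.mem_append.1 hz with hz | hz
            · obtain ⟨m, hm, hm'⟩ := hd₁ z hz
              refine ⟨m, hm, fun y hy => ?_⟩
              obtain ⟨j, hj, hj'⟩ := hm' y hy
              exact ⟨j, by simp [hj], hj'⟩
            · obtain ⟨m, hm, hm'⟩ := hd' z hz
              refine ⟨m, hm, fun y hy => ?_⟩
              obtain ⟨j, hj, hj'⟩ := hm' y hy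
              exact ⟨j, by simp [hj], hj'⟩
      obtain ⟨d, hd, hd'⟩ := key l (List.Subset.refl l)
      -- The new conclusion gets a rank above all ranks already in use.
      have hb : ∃ N, ∀ z ∈ d, z.2 < N := by
        refine ⟨(d.map Prod.snd).sum + 1, fun z hz => ?_⟩
        have := List.single_le_sum (l := d.map Prod.snd) (by simp) z.2
          (List.mem_map_of_mem hz)
        omega
      obtain ⟨N, hN⟩ := hb
      refine ⟨(x, N) :: d, N, by simp, fun z hz => ?_⟩
      rcases List.mem_cons.1 hz with rfl | hz
      · refine ⟨l, hl, fun y hy => ?_⟩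
        obtain ⟨k, hk⟩ := hd y hy
        exact ⟨k, by simp [hk], hN _ hk⟩
      · obtain ⟨m, hm, hm'⟩ := hd' z hz
        refine ⟨m, hm, fun y hy => ?_⟩
        obtain ⟨j, hj, hj'⟩ := hm' y hy
        exact ⟨j, by simp [hj], hj'⟩
  · rintro ⟨d, k, hk, hd⟩
    induction k using Nat.strong_induction_on generalizing x with
    | _ k ih =>
      obtain ⟨l, hl, hl'⟩ := hd _ hk
      refine .intro x l hl fun y hy => ?_
      obtain ⟨j, hj, hj'⟩ := hl' y hy
      exact ih j hj' hj

/-- Finite derivations can be searched for. This is how `Below` and `Decides` are shown to be c.e.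
-/
theorem SigmaOne.generated {β : Type*} [Primcodable β] {R : β → List β → Prop}
    (hR : SigmaOne fun x : β × List β => R x.1 x.2) : SigmaOne (Generated R) := by
  refine SigmaOne.of_eq ?_ fun x => generated_iff_exists_isDerivation.symm
  refine .exists' (.exists' (.and (.mem (by fun_prop) (by fun_prop)) ?_))
  refine .forall_mem (by fun_prop) (.exists' (.and ?_ ?_))
  · exact hR.comp (f := fun x : (((β × List (β × ℕ)) × ℕ) × β × ℕ) × List β => (x.1.2.1, x.2))
      (by fun_prop)
  · exact .forall_mem (by fun_prop) (.exists' (.and (.mem (by fun_prop) (by fun_prop))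
      (.lt (by fun_prop) (by fun_prop))))

/-! ### The order on notations as a computably enumerable relation -/

theorem two_pow_ne_three_mul_five_pow (b e : ℕ) : 2 ^ b ≠ 3 * 5 ^ e := by
  intro h
  have h3 : 3 ∣ 2 ^ b := h ▸ Dvd.intro _ rfl
  have := Nat.Prime.dvd_of_dvd_pow Nat.prime_three h3
  omega

theorem one_ne_three_mul_five_pow (e : ℕ) : 1 ≠ 3 * 5 ^ e := by
  simpa using two_pow_ne_three_mul_five_pow 0 e

theorem two_pow_inj {a b : ℕ} (h : 2 ^ a = 2 ^ b) : a = b :=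
  Nat.pow_right_injective le_rfl h

theorem three_mul_five_pow_inj {a b : ℕ} (h : 3 * 5 ^ a = 3 * 5 ^ b) : a = b :=
  Nat.pow_right_injective (by norm_num : 2 ≤ 5) (Nat.eq_of_mul_eq_mul_left (by norm_num) h)

theorem two_pow_ne_one {b : ℕ} (hb : b ≠ 0) : 2 ^ b ≠ 1 := by simpa using hb

/-- The computably enumerable relation that coincides with `<_𝒪` below each notation. -/
inductive Below : ℕ → ℕ → Prop
  | succ_self (b : ℕ) : b ≠ 0 → Below b (2 ^ b)
  | succ (u b : ℕ) : b ≠ 0 → Below u b → Below u (2 ^ b)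
  | lim_self (e n x : ℕ) : x ∈ phi e n → Below x (3 * 5 ^ e)
  | lim (u e n x : ℕ) : x ∈ phi e n → Below u x → Below u (3 * 5 ^ e)

/-- The reflexive closure of `Below`. -/
def BelowEq (u a : ℕ) : Prop := u = a ∨ Below u a

/-- The side condition `b ≠ 0` in the successor rules is essential: since `1 = 2 ^ 0`, without it
`0` would lie below `1`. -/
theorem not_below_one (u : ℕ) : ¬ Below u 1 := by
  intro h
  generalize ha : 1 = a at h
  cases h with
  | succ_self b hb => exact two_pow_ne_one hb ha.symm
  | succ u b hb => exact two_pow_ne_one hb ha.symm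
  | lim_self e => exact one_ne_three_mul_five_pow e ha
  | lim u e => exact one_ne_three_mul_five_pow e ha

theorem below_two_pow {u b : ℕ} (hb : b ≠ 0) : Below u (2 ^ b) ↔ BelowEq u b := by
  constructor
  · intro h
    generalize ha : 2 ^ b = a at h
    cases h with
    | succ_self c hc => exact .inl (two_pow_inj ha).symm
    | succ u c hc h => exact .inr (two_pow_inj ha ▸ h)
    | lim_self e => exact (two_pow_ne_three_mul_five_pow _ e ha).elim
    | lim u e => exact (two_pow_ne_three_mul_five_pow _ e ha).elim
  · rintro (rfl | h)
    · exact .succ_self _ hb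
    · exact .succ _ _ hb h

theorem below_three_mul_five_pow {u e : ℕ} :
    Below u (3 * 5 ^ e) ↔ ∃ n x, x ∈ phi e n ∧ BelowEq u x := by
  constructor
  · intro h
    generalize ha : 3 * 5 ^ e = a at h
    cases h with
    | succ_self c hc => exact (two_pow_ne_three_mul_five_pow _ e ha.symm).elim
    | succ u c hc h => exact (two_pow_ne_three_mul_five_pow _ e ha.symm).elim
    | lim_self d n x h => exact ⟨n, u, three_mul_five_pow_inj ha ▸ h, .inl rfl⟩
    | lim u d n x h h' => exact ⟨n, x, three_mul_five_pow_inj ha ▸ h, .inr h'⟩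
  · rintro ⟨n, x, hx, rfl | h⟩
    · exact .lim_self _ n _ hx
    · exact .lim _ _ n x hx h

theorem Below.trans {u v a : ℕ} (h : Below u v) (h' : Below v a) : Below u a := by
  induction h' with
  | succ_self b hb => exact .succ _ _ hb h
  | succ v b hb _ ih => exact .succ _ _ hb (ih h)
  | lim_self e n x hx => exact .lim _ _ n x hx h
  | lim v e n x hx _ ih => exact .lim _ _ n x hx (ih h)

theorem Below.trans_le {u v a : ℕ} (h : Below u v) (h' : BelowEq v a) : Below u a := by
  rcases h' with rfl | h'
  exacts [h, h.trans h']

theorem BelowEq.trans_lt {u v a : ℕ} (h : BelowEq u v) (h' : Below v a) : Below u a := by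
  rcases h with rfl | h
  exacts [h', h.trans h']

theorem BelowEq.trans {u v a : ℕ} (h : BelowEq u v) (h' : BelowEq v a) : BelowEq u a := by
  rcases h with rfl | h
  exacts [h', .inr (h.trans_le h')]

theorem sigmaOne_below : SigmaOne fun x : ℕ × ℕ => Below x.1 x.2 := by
  let R : ℕ × ℕ → List (ℕ × ℕ) → Prop := fun x l =>
    (∃ b, b ≠ 0 ∧ x.2 = 2 ^ b ∧ (x.1 = b ∨ (x.1, b) ∈ l)) ∨
    ∃ e n y, y ∈ phi e n ∧ x.2 = 3 * 5 ^ e ∧ (x.1 = y ∨ (x.1, y) ∈ l)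
  have hR : SigmaOne fun x : (ℕ × ℕ) × List (ℕ × ℕ) => R x.1 x.2 := by
    refine .or (.exists' (.and (.ne ?_ ?_) (.and (.eq ?_ ?_) (.or (.eq ?_ ?_) (.mem ?_ ?_)))))
      (.exists' (.exists' (.exists' (.and (.mem_phi ?_ ?_ ?_)
        (.and (.eq ?_ ?_) (.or (.eq ?_ ?_) (.mem ?_ ?_))))))) <;> fun_prop
  refine hR.generated.of_eq fun x => ⟨fun h => ?_, fun h => ?_⟩
  · induction h with
    | intro x l hl _ ih =>
      obtain ⟨u, a⟩ := x
      dsimp only [R] at hl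
      rcases hl with ⟨b, hb, rfl, rfl | h⟩ | ⟨e, n, y, hy, rfl, rfl | h⟩
      · exact .succ_self _ hb
      · exact .succ _ _ hb (ih _ h)
      · exact .lim_self _ n _ hy
      · exact .lim _ _ n y hy (ih _ h)
  · obtain ⟨u, a⟩ := x
    change Below u a at h
    induction h with
    | succ_self b hb => exact .intro _ [] (.inl ⟨b, hb, rfl, .inl rfl⟩) (by simp)
    | succ u b hb _ ih =>
      exact .intro _ [(u, b)] (.inl ⟨b, hb, rfl, .inr (by simp)⟩) (by simpa using ih)
    | lim_self e n x hx => exact .intro _ [] (.inr ⟨e, n, x, hx, rfl, .inl rfl⟩) (by simp)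
    | lim u e n x hx _ ih =>
      exact .intro _ [(u, x)] (.inr ⟨e, n, x, hx, rfl, .inr (by simp)⟩) (by simpa using ih)

theorem SigmaOne.below {α : Type*} [Primcodable α] {f g : α → ℕ} (hf : Primrec f)
    (hg : Primrec g) : SigmaOne fun a => Below (f a) (g a) :=
  sigmaOne_below.comp (hf.pair hg)

theorem SigmaOne.belowEq {α : Type*} [Primcodable α] {f g : α → ℕ} (hf : Primrec f)
    (hg : Primrec g) : SigmaOne fun a => BelowEq (f a) (g a) :=
  (SigmaOne.eq hf hg).or (.below hf hg)

/-! ### Notations -/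

theorem IsNotation.ne_zero {a : ℕ} {α : Ordinal.{0}} {P : Set ℕ} (h : IsNotation a α P) :
    a ≠ 0 := by
  cases h <;> positivity

/-- This ties `<_𝒪` to a c.e. relation. In the limit case the terms `f n` themselves count as
predecessors because `f n ∈ P (n + 1)`. -/
theorem IsNotation.mem_iff {a : ℕ} {α : Ordinal.{0}} {P : Set ℕ} (h : IsNotation a α P) :
    ∀ u, u ∈ P ↔ Below u a := by
  induction h with
  | one => exact fun u => by simp [not_below_one]
  | succ a α P h ih =>
    intro u
    rw [below_two_pow h.ne_zero, Set.mem_insert_iff, ih]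
    rfl
  | lim e f α P hf h hP ih =>
    intro u
    rw [below_three_mul_five_pow, Set.mem_iUnion]
    constructor
    · rintro ⟨n, hn⟩
      exact ⟨n, f n, hf n, .inr ((ih n u).1 hn)⟩
    · rintro ⟨n, x, hx, hu⟩
      obtain rfl := Part.mem_unique hx (hf n)
      rcases hu with rfl | hu
      · exact ⟨n + 1, hP n⟩
      · exact ⟨n, (ih n u).2 hu⟩

theorem InO.ne_zero {a : ℕ} (h : InO a) : a ≠ 0 := by
  obtain ⟨α, P, h⟩ := h
  exact h.ne_zero

theorem InO.one : InO 1 := ⟨_, _, .one⟩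

theorem InO.two_pow {a : ℕ} (h : InO a) : InO (2 ^ a) := by
  obtain ⟨α, P, h⟩ := h
  exact ⟨_, _, .succ _ _ _ h⟩

/-- Induction along the construction of notations. -/
@[elab_as_elim]
theorem InO.rec_on {p : ℕ → Prop} {a : ℕ} (ha : InO a) (one : p 1)
    (succ : ∀ b, InO b → p b → p (2 ^ b))
    (lim : ∀ (e : ℕ) (f : ℕ → ℕ), InO (3 * 5 ^ e) → (∀ n, f n ∈ phi e n) → (∀ n, InO (f n)) →
      (∀ n, Below (f n) (f (n + 1))) → (∀ n, p (f n)) → p (3 * 5 ^ e)) : p a := by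
  obtain ⟨α, P, h⟩ := ha
  induction h with
  | one => exact one
  | succ a α P h ih => exact succ a ⟨_, _, h⟩ ih
  | lim e f α P hf h hP ih =>
    exact lim e f ⟨_, _, .lim e f α P hf h hP⟩ hf (fun n => ⟨_, _, h n⟩)
      (fun n => ((h (n + 1)).mem_iff _).1 (hP n)) ih

theorem InO.of_below {u a : ℕ} (ha : InO a) (h : Below u a) : InO u := by
  revert h
  refine ha.rec_on (fun h => (not_below_one _ h).elim) (fun b hb ih h => ?_)
    fun e f _ hf h _ ih h' => ?_
  · rcases (below_two_pow hb.ne_zero).1 h with rfl | h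
    exacts [hb, ih h]
  · obtain ⟨n, x, hx, hu⟩ := below_three_mul_five_pow.1 h'
    obtain rfl := Part.mem_unique hx (hf n)
    rcases hu with rfl | hu
    exacts [h n, ih n hu]

theorem InO.of_belowEq {u a : ℕ} (ha : InO a) (h : BelowEq u a) : InO u := by
  rcases h with rfl | h
  exacts [ha, ha.of_below h]

/-- Induction along `<_𝒪`. -/
@[elab_as_elim]
theorem InO.strong_rec_on {p : ℕ → Prop} {a : ℕ} (ha : InO a)
    (step : ∀ a, InO a → (∀ u, Below u a → p u) → p a) : p a := by
  suffices h : p a ∧ ∀ u, Below u a → p u from h.1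
  refine ha.rec_on ?_ ?_ ?_
  · have h : ∀ u, Below u 1 → p u := fun u hu => (not_below_one u hu).elim
    exact ⟨step _ .one h, h⟩
  · intro b hb ih
    have h : ∀ u, Below u (2 ^ b) → p u := by
      intro u hu
      rcases (below_two_pow hb.ne_zero).1 hu with rfl | hu
      exacts [ih.1, ih.2 _ hu]
    exact ⟨step _ hb.two_pow h, h⟩
  · intro e f he hf _ _ ih
    have h : ∀ u, Below u (3 * 5 ^ e) → p u := by
      intro u hu
      obtain ⟨n, x, hx, hu⟩ := below_three_mul_five_pow.1 hu
      obtain rfl := Part.mem_unique hx (hf n)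
      rcases hu with rfl | hu
      exacts [(ih n).1, (ih n).2 _ hu]
    exact ⟨step _ he h, h⟩

theorem InO.cases {a : ℕ} (ha : InO a) :
    a = 1 ∨ (∃ b, InO b ∧ a = 2 ^ b) ∨ ∃ e, a = 3 * 5 ^ e :=
  ha.rec_on (.inl rfl) (fun b hb _ => .inr (.inl ⟨b, hb, rfl⟩))
    fun e _ _ _ _ _ _ => .inr (.inr ⟨e, rfl⟩)

theorem InO.of_two_pow {b : ℕ} (h : InO (2 ^ b)) (hb : b ≠ 0) : InO b :=
  h.of_below (.succ_self b hb)

theorem ltO_iff {u a : ℕ} : LtO u a ↔ InO a ∧ Below u a := by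
  constructor
  · rintro ⟨α, P, h, hu⟩
    exact ⟨⟨α, P, h⟩, (h.mem_iff u).1 hu⟩
  · rintro ⟨⟨α, P, h⟩, hu⟩
    exact ⟨α, P, h, (h.mem_iff u).2 hu⟩

theorem InO.one_belowEq {a : ℕ} (ha : InO a) : BelowEq 1 a :=
  ha.rec_on (.inl rfl) (fun _ hb ih => .inr (ih.trans_lt (.succ_self _ hb.ne_zero)))
    fun _ _ _ hf _ _ ih => .inr ((ih 0).trans_lt (.lim_self _ 0 _ (hf 0)))

/-- At a limit, `u ≤ f n < f (n + 1)`, so induction applies to `f (n + 1)`, which still lies below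
the limit. -/
theorem InO.two_pow_belowEq {u a : ℕ} (ha : InO a) (h : Below u a) : BelowEq (2 ^ u) a := by
  revert h
  refine ha.rec_on (fun h => (not_below_one _ h).elim) (fun b hb ih h => ?_)
    fun e f _ hf h hlt ih h' => ?_
  · rcases (below_two_pow hb.ne_zero).1 h with rfl | h
    · exact .inl rfl
    · exact .inr ((ih h).trans_lt (.succ_self _ hb.ne_zero))
  · obtain ⟨n, x, hx, hu⟩ := below_three_mul_five_pow.1 h'
    obtain rfl := Part.mem_unique hx (hf n)
    exact .inr ((ih (n + 1) (hu.trans_lt (hlt n))).trans_lt (.lim_self _ _ _ (hf (n + 1))))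

theorem InO.two_belowEq {a : ℕ} (ha : InO a) (h : a ≠ 1) : BelowEq 2 a := by
  rcases ha.one_belowEq with h' | h'
  · exact (h h'.symm).elim
  · exact ha.two_pow_belowEq h'

theorem belowEq_of_le {f : ℕ → ℕ} (hf : ∀ n, Below (f n) (f (n + 1))) {m n : ℕ} (h : m ≤ n) :
    BelowEq (f m) (f n) := by
  induction h with
  | refl => exact .inl rfl
  | step _ ih => exact .inr (ih.trans_lt (hf _))

/-- Two predecessors of a limit both lie weakly below one term `f (max n m)`, where induction
compares them. -/
theorem InO.belowEq_total {u v a : ℕ} (ha : InO a) (hu : BelowEq u a) (hv : BelowEq v a) :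
    BelowEq u v ∨ BelowEq v u := by
  revert hu hv
  refine ha.rec_on ?_ ?_ ?_
  · rintro (rfl | hu) hv
    · exact .inr hv
    · exact (not_below_one _ hu).elim
  · rintro b hb ih (rfl | hu) hv
    · exact .inr hv
    · rcases hv with rfl | hv
      · exact .inl (.inr hu)
      · exact ih ((below_two_pow hb.ne_zero).1 hu) ((below_two_pow hb.ne_zero).1 hv)
  · rintro e f - hf - hlt ih (rfl | hu) hv
    · exact .inr hv
    · rcases hv with rfl | hv
      · exact .inl (.inr hu)
      · obtain ⟨n, x, hx, hu⟩ := below_three_mul_five_pow.1 hu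
        obtain rfl := Part.mem_unique hx (hf n)
        obtain ⟨m, y, hy, hv⟩ := below_three_mul_five_pow.1 hv
        obtain rfl := Part.mem_unique hy (hf m)
        exact ih (max n m) (hu.trans (belowEq_of_le hlt (le_max_left n m)))
          (hv.trans (belowEq_of_le hlt (le_max_right n m)))

theorem InO.exists_upper_bound {u v a : ℕ} (ha : InO a) (hu : Below u a) (hv : Below v a) :
    ∃ w, Below w a ∧ BelowEq u w ∧ BelowEq v w := by
  rcases ha.belowEq_total (.inr hu) (.inr hv) with h | h
  exacts [⟨v, hv, h, .inl rfl⟩, ⟨u, hu, .inl rfl, h⟩]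

/-! ### The ordinal denoted by a notation -/

theorem IsNotation.ordinal_unique {a : ℕ} {α : Ordinal.{0}} {P : Set ℕ} (h : IsNotation a α P) :
    ∀ {β Q}, IsNotation a β Q → α = β := by
  induction h with
  | one =>
    intro β Q h
    generalize ha : 1 = a at h
    cases h with
    | one => rfl
    | succ b β P h => exact (two_pow_ne_one h.ne_zero ha.symm).elim
    | lim e => exact (one_ne_three_mul_five_pow e ha).elim
  | succ a α P h ih =>
    intro β Q h'
    generalize ha : 2 ^ a = c at h'
    cases h' with
    | one => exact (two_pow_ne_one h.ne_zero ha).elim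
    | succ b β P h' =>
      obtain rfl := two_pow_inj ha
      rw [ih h']
    | lim e => exact (two_pow_ne_three_mul_five_pow _ e ha).elim
  | lim e f α P hf h hP ih =>
    intro β Q h'
    generalize ha : 3 * 5 ^ e = c at h'
    cases h' with
    | one => exact (one_ne_three_mul_five_pow e ha.symm).elim
    | succ b β P h' => exact (two_pow_ne_three_mul_five_pow _ e ha.symm).elim
    | lim e' f' α' P' hf' h' hP' =>
      obtain rfl := three_mul_five_pow_inj ha
      obtain rfl : f = f' := funext fun n => Part.mem_unique (hf n) (hf' n)
      exact congrArg _ (funext fun n => ih n (h' n))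

theorem IsNotation.exists_lt {a : ℕ} {α : Ordinal.{0}} {P : Set ℕ} (h : IsNotation a α P) :
    ∀ b ∈ P, ∃ β < α, ∃ Q, IsNotation b β Q := by
  induction h with
  | one => simp
  | succ a α P h ih =>
    intro b hb
    rcases Set.mem_insert_iff.1 hb with rfl | hb
    · exact ⟨α, Order.lt_succ α, P, h⟩
    · obtain ⟨β, hβ, hQ⟩ := ih b hb
      exact ⟨β, hβ.trans (Order.lt_succ α), hQ⟩
  | lim e f α P hf h hP ih =>
    intro b hb
    obtain ⟨n, hn⟩ := Set.mem_iUnion.1 hb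
    obtain ⟨β, hβ, hQ⟩ := ih n b hn
    exact ⟨β, hβ.trans_le (Ordinal.le_iSup α n), hQ⟩

/-- The ordinals `α n` increase strictly, so `n ≤ α n`. -/
theorem omega0_le_iSup_of_isNotation {f : ℕ → ℕ} {α : ℕ → Ordinal.{0}} {P : ℕ → Set ℕ}
    (h : ∀ n, IsNotation (f n) (α n) (P n)) (hP : ∀ n, f n ∈ P (n + 1)) :
    Ordinal.omega0 ≤ ⨆ n, α n := by
  have hlt : ∀ n, α n < α (n + 1) := by
    intro n
    obtain ⟨β, hβ, Q, hQ⟩ := (h (n + 1)).exists_lt _ (hP n)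
    rwa [(h n).ordinal_unique hQ]
  have hle : ∀ n : ℕ, (n : Ordinal.{0}) ≤ α n := by
    intro n
    induction n with
    | zero => simp
    | succ n ih =>
      rw [Nat.cast_succ]
      exact Order.add_one_le_of_lt (ih.trans_lt (hlt n))
  exact Ordinal.omega0_le.2 fun n => (hle n).trans (Ordinal.le_iSup α n)

/-! ### Levels -/

/-- The notations `1, 2, 4, 16, …` of the finite ordinals. -/
def finNotation (k : ℕ) : ℕ := Nat.rec 1 (fun _ x => 2 ^ x) k

/-- This bounds the search for `k` in `IsFinNotation`, which is what makes `level` primitive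
recursive. -/
theorem lt_finNotation (k : ℕ) : k < finNotation k := by
  induction k with
  | zero => exact Nat.one_pos
  | succ k ih => exact lt_of_le_of_lt ih (Nat.lt_two_pow_self (n := finNotation k))

/-- `a` denotes a finite ordinal. -/
def IsFinNotation (a : ℕ) : Prop := ∃ k, finNotation k = a

open Classical in
/-- A notation of `1 + |a|`. -/
noncomputable def level (a : ℕ) : ℕ := if IsFinNotation a then 2 ^ a else a

theorem primrec_finNotation : Primrec finNotation :=
  Primrec.nat_rec₁ 1 (f := fun _ x => 2 ^ x) (show Primrec fun x : ℕ × ℕ => 2 ^ x.2 by fun_prop)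

theorem primrec_level : Primrec level := by
  classical
  have h : PrimrecPred IsFinNotation := by
    refine PrimrecPred.of_eq (p := fun a => ∃ k ∈ List.range a, finNotation k = a) ?_ fun a => ?_
    · exact (PrimrecRel.exists_mem_list (R := fun k a => finNotation k = a)
        (Primrec.eq.comp (primrec_finNotation.comp Primrec.fst) Primrec.snd)).comp
          Primrec.list_range Primrec.id
    · constructor
      · rintro ⟨k, -, hk⟩
        exact ⟨k, hk⟩
      · rintro ⟨k, rfl⟩
        exact ⟨k, by simpa using lt_finNotation k, rfl⟩
  exact Primrec.ite h (by fun_prop) Primrec.id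

@[fun_prop]
theorem primrec_level_comp {α : Type*} [Primcodable α] {f : α → ℕ} (hf : Primrec f) :
    Primrec fun a => level (f a) :=
  primrec_level.comp hf

theorem isFinNotation_one : IsFinNotation 1 := ⟨0, rfl⟩

theorem isFinNotation_two_pow {b : ℕ} (hb : b ≠ 0) : IsFinNotation (2 ^ b) ↔ IsFinNotation b := by
  constructor
  · rintro ⟨_ | k, hk⟩
    · exact (two_pow_ne_one hb hk.symm).elim
    · exact ⟨k, two_pow_inj hk⟩
  · rintro ⟨k, rfl⟩
    exact ⟨k + 1, rfl⟩

theorem not_isFinNotation_three_mul_five_pow (e : ℕ) : ¬ IsFinNotation (3 * 5 ^ e) := by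
  rintro ⟨_ | k, hk⟩
  · exact one_ne_three_mul_five_pow e hk
  · exact two_pow_ne_three_mul_five_pow _ e hk

theorem level_one : level 1 = 2 := by simp [level, isFinNotation_one]

theorem level_two_pow {b : ℕ} (hb : b ≠ 0) : level (2 ^ b) = 2 ^ level b := by
  by_cases h : IsFinNotation b <;> simp [level, isFinNotation_two_pow hb, h]

theorem level_three_mul_five_pow (e : ℕ) : level (3 * 5 ^ e) = 3 * 5 ^ e := by
  simp [level, not_isFinNotation_three_mul_five_pow]

theorem level_ne_one {b : ℕ} (hb : b ≠ 0) : level b ≠ 1 := by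
  unfold level
  split_ifs with h
  · exact two_pow_ne_one hb
  · rintro rfl
    exact h isFinNotation_one

/-- `1 + (α + 1) = (1 + α) + 1`, while an infinite limit absorbs a `1` added on the left. This
matches the index shift in the definition of `Σ⁰_α`. -/
theorem IsNotation.denotes_level {a : ℕ} {α : Ordinal.{0}} {P : Set ℕ} (h : IsNotation a α P) :
    Denotes (level a) (1 + α) := by
  induction h with
  | one => exact ⟨_, by simpa [level_one] using IsNotation.succ 1 0 ∅ .one⟩
  | succ a α P h ih =>
    obtain ⟨Q, hQ⟩ := ih
    rw [level_two_pow h.ne_zero, Order.succ_eq_add_one, ← add_assoc, ← Order.succ_eq_add_one]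
    exact ⟨_, .succ _ _ _ hQ⟩
  | lim e f α P hf h hP ih =>
    rw [level_three_mul_five_pow,
      Ordinal.one_add_of_omega0_le (omega0_le_iSup_of_isNotation h hP)]
    exact ⟨_, .lim e f α P hf h hP⟩

theorem InO.level {a : ℕ} (h : InO a) : InO (level a) := by
  obtain ⟨α, P, h⟩ := h
  obtain ⟨Q, hQ⟩ := h.denotes_level
  exact ⟨_, Q, hQ⟩

theorem InO.of_level {b : ℕ} (h : InO (HypNum.level b)) (hb : b ≠ 0) : InO b := by
  unfold HypNum.level at h
  split_ifs at h
  exacts [h.of_two_pow hb, h]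

theorem InO.level_belowEq {u a : ℕ} (ha : InO a) (h : Below u a) : BelowEq (HypNum.level u) a := by
  unfold HypNum.level
  split_ifs
  exacts [ha.two_pow_belowEq h, .inr h]

/-! ### The sets `H(a)` -/

/-- The set `H(a)`, for `a ∈ 𝒪`. -/
def hSet (a : ℕ) : Set ℕ := {m | ∃ X, IsH a X ∧ m ∈ X}

theorem IsH.ne_zero {a : ℕ} {X : Set ℕ} (h : IsH a X) : a ≠ 0 := by
  cases h <;> positivity

theorem IsH.unique {a : ℕ} {X : Set ℕ} (h : IsH a X) : ∀ {Y}, IsH a Y → X = Y := by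
  induction h with
  | one =>
    intro Y h
    generalize ha : 1 = a at h
    cases h with
    | one => rfl
    | succ b X h => exact (two_pow_ne_one h.ne_zero ha.symm).elim
    | lim e => exact (one_ne_three_mul_five_pow e ha).elim
  | succ a X h ih =>
    intro Y h'
    generalize ha : 2 ^ a = c at h'
    cases h' with
    | one => exact (two_pow_ne_one h.ne_zero ha).elim
    | succ b X h' =>
      obtain rfl := two_pow_inj ha
      rw [ih h']
    | lim e => exact (two_pow_ne_three_mul_five_pow _ e ha).elim
  | lim e Y he h ih =>
    intro Z h'
    generalize ha : 3 * 5 ^ e = c at h'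
    cases h' with
    | one => exact (one_ne_three_mul_five_pow e ha.symm).elim
    | succ b X h' => exact (two_pow_ne_three_mul_five_pow _ e ha.symm).elim
    | lim e' Y' he' h' =>
      obtain rfl := three_mul_five_pow_inj ha
      ext m
      refine and_congr_right fun hm => ?_
      rw [ih _ hm (h' _ hm)]

theorem IsH.eq_hSet {a : ℕ} {X : Set ℕ} (h : IsH a X) : X = hSet a :=
  Set.ext fun _ => ⟨fun hm => ⟨X, h, hm⟩, fun ⟨_, hY, hm⟩ => h.unique hY ▸ hm⟩

theorem isH_hSet {a : ℕ} (ha : InO a) : IsH a (hSet a) := by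
  refine ha.strong_rec_on fun a ha ih => ?_
  suffices h : ∃ X, IsH a X by
    obtain ⟨X, hX⟩ := h
    exact hX.eq_hSet ▸ hX
  rcases ha.cases with rfl | ⟨b, hb, rfl⟩ | ⟨e, rfl⟩
  · exact ⟨_, .one⟩
  · exact ⟨_, .succ _ _ (ih b (.succ_self b hb.ne_zero))⟩
  · exact ⟨_, .lim e hSet ha fun u hu => ih u (ltO_iff.1 hu).2⟩

theorem hSet_one : hSet 1 = ∅ := IsH.one.eq_hSet.symm

theorem hSet_two_pow {b : ℕ} (hb : InO b) : hSet (2 ^ b) = jump (hSet b) :=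
  (IsH.succ _ _ (isH_hSet hb)).eq_hSet.symm

theorem mem_hSet_three_mul_five_pow {e m : ℕ} (he : InO (3 * 5 ^ e)) :
    m ∈ hSet (3 * 5 ^ e) ↔ Below m.unpair.1 (3 * 5 ^ e) ∧ m.unpair.2 ∈ hSet m.unpair.1 := by
  rw [← (IsH.lim e hSet he fun u hu => isH_hSet (he.of_below (ltO_iff.1 hu).2)).eq_hSet]
  exact and_congr_left fun _ => ltO_iff.trans (and_iff_right he)

/-! ### Finite conditions on the sets `H(a)`

An item `(a, m)` stands for a fact implying `m ∉ H(a)`: this statement itself if `a` denotes a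
successor, and `m.unpair.1 ≮_𝒪 a` if `a` denotes a limit. Any other item is regarded as false.
A condition is a finite list of items, understood as their conjunction. -/

/-- The condition `c` settles by a finite computation that `m ∈ H(a)`, if `t = true`, or that
`m ∉ H(a)`, if `t = false`. -/
inductive Decides (c : List (ℕ × ℕ)) : ℕ → ℕ → Bool → Prop
  | one (m : ℕ) : Decides c 1 m false
  | item (a m : ℕ) : (a, m) ∈ c → Decides c a m false
  | jump (b m : ℕ) (τ : List Bool) : b ≠ 0 → Nat.pair m (encode τ) ∈ W m →
      (∀ i (h : i < τ.length), Decides c b i τ[i]) → Decides c (2 ^ b) m true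
  | lim (e m : ℕ) (t : Bool) : Below m.unpair.1 (3 * 5 ^ e) →
      Decides c m.unpair.1 m.unpair.2 t → Decides c (3 * 5 ^ e) m t

/-- The condition `c` settles that `τ` is an initial segment of `H(a)`. -/
def DecidesSeg (c : List (ℕ × ℕ)) (a : ℕ) (τ : List Bool) : Prop :=
  ∀ i (h : i < τ.length), Decides c a i τ[i]

theorem decidesSeg_iff {c : List (ℕ × ℕ)} {a : ℕ} {τ : List Bool} :
    DecidesSeg c a τ ↔ ∀ i ∈ List.range τ.length, ∃ s, τ[i]? = some s ∧ Decides c a i s := by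
  constructor
  · intro h i hi
    have hi := List.mem_range.1 hi
    exact ⟨τ[i], List.getElem?_eq_getElem hi, h i hi⟩
  · intro h i hi
    obtain ⟨s, hs, hs'⟩ := h i (List.mem_range.2 hi)
    rw [List.getElem?_eq_getElem hi, Option.some_inj] at hs
    exact hs ▸ hs'

theorem sigmaOne_decides :
    SigmaOne fun x : List (ℕ × ℕ) × ℕ × ℕ × Bool => Decides x.1 x.2.1 x.2.2.1 x.2.2.2 := by
  let R : List (ℕ × ℕ) × ℕ × ℕ × Bool → List (List (ℕ × ℕ) × ℕ × ℕ × Bool) → Prop := fun x l =>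
    (x.2.1 = 1 ∧ x.2.2.2 = false) ∨
    ((x.2.1, x.2.2.1) ∈ x.1 ∧ x.2.2.2 = false) ∨
    (∃ b, ∃ τ : List Bool, b ≠ 0 ∧ x.2.1 = 2 ^ b ∧ x.2.2.2 = true ∧
      Nat.pair x.2.2.1 (encode τ) ∈ W x.2.2.1 ∧
      ∀ i ∈ List.range τ.length, ∃ s, τ[i]? = some s ∧ (x.1, b, i, s) ∈ l) ∨
    ∃ e, x.2.1 = 3 * 5 ^ e ∧ Below x.2.2.1.unpair.1 x.2.1 ∧
      (x.1, x.2.2.1.unpair.1, x.2.2.1.unpair.2, x.2.2.2) ∈ l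
  have hR : SigmaOne fun x : (List (ℕ × ℕ) × ℕ × ℕ × Bool) ×
      List (List (ℕ × ℕ) × ℕ × ℕ × Bool) => R x.1 x.2 := by
    refine .or (.and (.eq ?_ ?_) (.eq ?_ ?_)) (.or (.and (.mem ?_ ?_) (.eq ?_ ?_)) (.or ?_ ?_))
    case refine_9 =>
      refine .exists' (.exists' (.and (.ne ?_ ?_) (.and (.eq ?_ ?_) (.and (.eq ?_ ?_)
        (.and (.mem_W ?_ ?_) (.forall_mem (Primrec.list_range.comp ?_)
          (.exists' (.and (.eq ?_ ?_) (.mem ?_ ?_)))))))))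
      all_goals fun_prop
    case refine_10 =>
      refine .exists' (.and (.eq ?_ ?_) (.and (.below ?_ ?_) (.mem ?_ ?_))) <;> fun_prop
    all_goals fun_prop
  refine hR.generated.of_eq fun x => ⟨fun h => ?_, fun h => ?_⟩
  · induction h with
    | intro x l hl _ ih =>
      obtain ⟨c, a, m, t⟩ := x
      dsimp only [R] at hl ⊢
      rcases hl with ⟨rfl, rfl⟩ | ⟨h, rfl⟩ | ⟨b, τ, hb, rfl, rfl, hτ, h⟩ | ⟨e, rfl, h, h'⟩
      · exact .one m
      · exact .item _ _ h
      · refine .jump b m τ hb hτ (decidesSeg_iff.2 fun i hi => ?_)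
        obtain ⟨s, hs, hs'⟩ := h i hi
        exact ⟨s, hs, ih _ hs'⟩
      · exact .lim e m t h (ih _ h')
  · obtain ⟨c, a, m, t⟩ := x
    change Decides c a m t at h
    induction h with
    | one m => exact .intro _ [] (.inl ⟨rfl, rfl⟩) (by simp)
    | item a m h => exact .intro _ [] (.inr (.inl ⟨h, rfl⟩)) (by simp)
    | jump b m τ hb hτ _ ih =>
      refine .intro _ ((List.finRange τ.length).map fun i => (c, b, i.1, τ[i]))
        (.inr (.inr (.inl ⟨b, τ, hb, rfl, rfl, hτ, fun i hi => ?_⟩))) fun y hy => ?_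
      · have hi := List.mem_range.1 hi
        exact ⟨τ[i], List.getElem?_eq_getElem hi, List.mem_map.2 ⟨⟨i, hi⟩, by simp, rfl⟩⟩
      · obtain ⟨i, -, rfl⟩ := List.mem_map.1 hy
        exact ih i.1 i.2
    | lim e m t h _ ih =>
      exact .intro _ [(c, m.unpair.1, m.unpair.2, t)]
        (.inr (.inr (.inr ⟨e, rfl, h, by simp⟩))) (by simpa using ih)

theorem SigmaOne.decidesSeg {α : Type*} [Primcodable α] {c : α → List (ℕ × ℕ)} {a : α → ℕ}
    {τ : α → List Bool} (hc : Primrec c) (ha : Primrec a) (hτ : Primrec τ) :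
    SigmaOne fun x => DecidesSeg (c x) (a x) (τ x) := by
  refine SigmaOne.of_eq ?_ fun x => decidesSeg_iff.symm
  refine .forall_mem (Primrec.list_range.comp (by fun_prop)) (.exists' (.and (.eq ?_ ?_) ?_))
  · fun_prop
  · fun_prop
  · exact sigmaOne_decides.comp (f := fun y : (α × ℕ) × Bool => (c y.1.1, a y.1.1, y.1.2, y.2))
      (by fun_prop)

theorem Decides.mono {c c' : List (ℕ × ℕ)} {a m : ℕ} {t : Bool} (h : Decides c a m t)
    (hc : c ⊆ c') : Decides c' a m t := by
  induction h with
  | one m => exact .one m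
  | item a m h => exact .item _ _ (hc h)
  | jump b m τ hb hτ _ ih => exact .jump b m τ hb hτ ih
  | lim e m t h _ ih => exact .lim e m t h ih

/-- The truth of an item. -/
def ItemTrue (x : ℕ × ℕ) : Prop :=
  (∃ b, b ≠ 0 ∧ x.1 = 2 ^ b ∧ x.2 ∉ hSet (2 ^ b)) ∨
    ∃ e, x.1 = 3 * 5 ^ e ∧ ¬ Below x.2.unpair.1 (3 * 5 ^ e)

/-- The truth of a condition. -/
def CondTrue (c : List (ℕ × ℕ)) : Prop := ∀ x ∈ c, ItemTrue x

theorem condTrue_nil : CondTrue [] := by simp [CondTrue]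

theorem not_itemTrue_zero (m : ℕ) : ¬ ItemTrue (0, m) := by
  rintro (⟨b, -, h, -⟩ | ⟨e, h, -⟩)
  · exact (pow_ne_zero b two_ne_zero) h.symm
  · exact (by positivity : 3 * 5 ^ e ≠ 0) h.symm

theorem not_condTrue_zero : ¬ CondTrue [(0, 0)] :=
  fun h => not_itemTrue_zero 0 (h _ (by simp))

theorem itemTrue_two_pow {b m : ℕ} (hb : b ≠ 0) : ItemTrue (2 ^ b, m) ↔ m ∉ hSet (2 ^ b) := by
  constructor
  · rintro (⟨b', -, h, h'⟩ | ⟨e, h, -⟩)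
    · rwa [two_pow_inj h]
    · exact (two_pow_ne_three_mul_five_pow _ _ h).elim
  · exact fun h => .inl ⟨b, hb, rfl, h⟩

theorem itemTrue_three_mul_five_pow {e m : ℕ} :
    ItemTrue (3 * 5 ^ e, m) ↔ ¬ Below m.unpair.1 (3 * 5 ^ e) := by
  constructor
  · rintro (⟨b', -, h, h'⟩ | ⟨e', h, h'⟩)
    · exact (two_pow_ne_three_mul_five_pow _ _ h.symm).elim
    · rwa [three_mul_five_pow_inj h]
  · exact fun h => .inr ⟨e, rfl, h⟩

theorem not_mem_hSet_of_itemTrue {a m : ℕ} (ha : InO a) (h : ItemTrue (a, m)) : m ∉ hSet a := by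
  rcases h with ⟨b, -, h, h'⟩ | ⟨e, h, h'⟩
  · rwa [show a = 2 ^ b from h]
  · obtain rfl : a = 3 * 5 ^ e := h
    rw [mem_hSet_three_mul_five_pow ha]
    exact fun h => h' h.1

/-- Negative facts come from true items and positive ones from actual computations. Membership in
`𝒪` passes from `a` to each notation the derivation descends to. -/
theorem Decides.sound {c : List (ℕ × ℕ)} {a m : ℕ} {t : Bool} (h : Decides c a m t)
    (hc : CondTrue c) (ha : InO a) : t = true ↔ m ∈ hSet a := by
  induction h with
  | one m => simp [hSet_one]
  | item a m h => simpa using not_mem_hSet_of_itemTrue ha (hc _ h)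
  | jump b m τ hb hτ _ ih =>
    have hb' := ha.of_two_pow hb
    rw [hSet_two_pow hb']
    exact iff_of_true rfl ⟨τ, fun i hi => ih i hi hb', hτ⟩
  | lim e m t h _ ih =>
    rw [mem_hSet_three_mul_five_pow ha, and_iff_right h]
    exact ih (ha.of_below h)

theorem DecidesSeg.sound {c : List (ℕ × ℕ)} {a : ℕ} {τ : List Bool} (h : DecidesSeg c a τ)
    (hc : CondTrue c) (ha : InO a) : IsInitSeg τ (hSet a) :=
  fun i hi => (h i hi).sound hc ha

/-- Every item of `c` is false or expressible by a `Π` formula of level `l`. -/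
def Admissible (l : ℕ) (c : List (ℕ × ℕ)) : Prop :=
  ∀ x ∈ c, x.1 = 0 ∨ (∃ b, b ≠ 0 ∧ x.1 = 2 ^ b ∧ BelowEq (level b) l) ∨
    ∃ e, x.1 = 3 * 5 ^ e ∧ BelowEq 2 l

theorem SigmaOne.admissible {α : Type*} [Primcodable α] {l : α → ℕ} {c : α → List (ℕ × ℕ)}
    (hl : Primrec l) (hc : Primrec c) : SigmaOne fun x => Admissible (l x) (c x) := by
  refine .forall_mem hc (.or (.eq ?_ ?_) (.or (.exists' (.and (.ne ?_ ?_) (.and (.eq ?_ ?_)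
    (.belowEq ?_ ?_)))) (.exists' (.and (.eq ?_ ?_) (.belowEq ?_ ?_))))) <;> fun_prop

theorem Admissible.mono {l l' : ℕ} {c : List (ℕ × ℕ)} (h : Admissible l c) (hl : BelowEq l l') :
    Admissible l' c := by
  intro x hx
  rcases h x hx with h | ⟨b, hb, h, h'⟩ | ⟨e, h, h'⟩
  exacts [.inl h, .inr (.inl ⟨b, hb, h, h'.trans hl⟩), .inr (.inr ⟨e, h, h'.trans hl⟩)]

theorem Admissible.append {l : ℕ} {c c' : List (ℕ × ℕ)} (h : Admissible l c)
    (h' : Admissible l c') : Admissible l (c ++ c') := fun x hx =>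
  (List.mem_append.1 hx).elim (h x) (h' x)

theorem admissible_nil (l : ℕ) : Admissible l [] := by simp [Admissible]

/-- At the notation `1` of the ordinal `0` only false items are admissible, so a leaf condition is
true exactly when it is empty, which is decidable. -/
theorem Admissible.fst_eq_zero {c : List (ℕ × ℕ)} (h : Admissible 1 c) :
    ∀ x ∈ c, x.1 = 0 := by
  intro x hx
  rcases h x hx with h | ⟨b, hb, -, h' | h'⟩ | ⟨e, -, h' | h'⟩
  · exact h
  · exact (level_ne_one hb h').elim
  · exact (not_below_one _ h').elim
  · exact absurd h' (by norm_num)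
  · exact (not_below_one _ h').elim

/-- The true conditions settling the single bits are concatenated. Their levels are comparable below
`level a`, so one of them bounds all and stays strictly below; soundness forces the settled bits to
agree with `τ`. -/
theorem exists_decides_seg {a : ℕ} (ha : InO a)
    (h : ∀ m, ∃ l c, Below l (level a) ∧ Admissible l c ∧ CondTrue c ∧
      ∃ t, Decides c a m t) {τ : List Bool} (hτ : IsInitSeg τ (hSet a)) :
    ∃ l c, Below l (level a) ∧ Admissible l c ∧ CondTrue c ∧ DecidesSeg c a τ := by
  have key : ∀ n, ∃ l c, Below l (level a) ∧ Admissible l c ∧ CondTrue c ∧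
      ∀ m < n, ∃ t, Decides c a m t := by
    intro n
    induction n with
    | zero =>
      refine ⟨1, [], ?_, admissible_nil 1, condTrue_nil, by simp⟩
      exact ha.level.one_belowEq.resolve_left (level_ne_one ha.ne_zero).symm
    | succ n ih =>
      obtain ⟨l₁, c₁, hl₁, ha₁, ht₁, hd₁⟩ := ih
      obtain ⟨l₂, c₂, hl₂, ha₂, ht₂, t₂, hd₂⟩ := h n
      obtain ⟨l, hl, h₁, h₂⟩ := ha.level.exists_upper_bound hl₁ hl₂
      refine ⟨l, c₁ ++ c₂, hl, (ha₁.mono h₁).append (ha₂.mono h₂), fun x hx => ?_, fun m hm => ?_⟩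
      · exact (List.mem_append.1 hx).elim (ht₁ x) (ht₂ x)
      · rcases Nat.lt_succ_iff_lt_or_eq.1 hm with hm | rfl
        · obtain ⟨t, ht⟩ := hd₁ m hm
          exact ⟨t, ht.mono (by simp)⟩
        · exact ⟨t₂, hd₂.mono (by simp)⟩
  obtain ⟨l, c, hl, hac, hc, hd⟩ := key τ.length
  refine ⟨l, c, hl, hac, hc, fun i hi => ?_⟩
  obtain ⟨t, ht⟩ := hd i hi
  have : t = τ[i] := Bool.eq_iff_iff.2 ((ht.sound hc ha).trans (hτ i hi).symm)
  exact this ▸ ht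

/-- At `2 ^ b`, a positive fact needs only an initial segment of `H(b)`, settled by induction, and a
negative one is itself an item of level `level b`. At a limit, a membership question passes to a
predecessor `u`, whose level is at most the limit. -/
theorem InO.exists_decides {a : ℕ} (ha : InO a) (m : ℕ) :
    ∃ l c, Below l (HypNum.level a) ∧ Admissible l c ∧ CondTrue c ∧ ∃ t, Decides c a m t := by
  revert m
  refine ha.strong_rec_on fun a ha ih => ?_
  intro m
  rcases ha.cases with rfl | ⟨b, hb, rfl⟩ | ⟨e, rfl⟩
  · refine ⟨1, [], ?_, admissible_nil 1, condTrue_nil, false, .one m⟩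
    rw [level_one]
    exact .succ_self 1 one_ne_zero
  · have hbb : Below b (2 ^ b) := .succ_self b hb.ne_zero
    refine ⟨HypNum.level b, ?_⟩
    have hlt : Below (HypNum.level b) (HypNum.level (2 ^ b)) := by
      rw [level_two_pow hb.ne_zero]
      exact .succ_self _ hb.level.ne_zero
    by_cases hm : m ∈ hSet (2 ^ b)
    · have hm' := hm
      rw [hSet_two_pow hb] at hm'
      obtain ⟨τ, hτ, hW⟩ := hm'
      obtain ⟨l, c, hl, hac, hc, hd⟩ := exists_decides_seg hb (ih b hbb) hτ
      exact ⟨c, hlt, hac.mono (.inr hl), hc, true, .jump b m τ hb.ne_zero hW hd⟩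
    · refine ⟨[(2 ^ b, m)], hlt, ?_, ?_, false, .item _ _ (by simp)⟩
      · intro x hx
        obtain rfl := List.mem_singleton.1 hx
        exact .inr (.inl ⟨b, hb.ne_zero, rfl, .inl rfl⟩)
      · intro x hx
        obtain rfl := List.mem_singleton.1 hx
        exact (itemTrue_two_pow hb.ne_zero).2 hm
  · rw [level_three_mul_five_pow]
    by_cases hm : Below m.unpair.1 (3 * 5 ^ e)
    · obtain ⟨l, c, hl, hac, hc, t, ht⟩ := ih _ hm m.unpair.2
      exact ⟨l, c, hl.trans_le (ha.level_belowEq hm), hac, hc, t, .lim e m t hm ht⟩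
    -- `Below` is c.e., so its failure is a `Π_1` fact, and `2` is the notation of `1`.
    · refine ⟨2, [(3 * 5 ^ e, m)], ?_, ?_, ?_, false, .item _ _ (by simp)⟩
      · refine (ha.two_belowEq (one_ne_three_mul_five_pow e).symm).resolve_left ?_
        simpa using two_pow_ne_three_mul_five_pow 1 e
      · intro x hx
        obtain rfl := List.mem_singleton.1 hx
        exact .inr (.inr ⟨e, rfl, .inl rfl⟩)
      · intro x hx
        obtain rfl := List.mem_singleton.1 hx
        exact itemTrue_three_mul_five_pow.2 hm

theorem InO.exists_decidesSeg {a : ℕ} (ha : InO a) {τ : List Bool} (hτ : IsInitSeg τ (hSet a)) :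
    ∃ l c, Below l (HypNum.level a) ∧ Admissible l c ∧ CondTrue c ∧ DecidesSeg c a τ :=
  exists_decides_seg ha ha.exists_decides hτ

/-! ### The tree of conditions -/

/-- The node `y = (l', c')` is a child of the node `x = (l, c)`: a condition is true if and only
if the conditions at its children are false. -/
def Child (x y : ℕ × List (ℕ × ℕ)) : Prop :=
  (y.1 = 1 ∧ y.2 = [(0, 0)]) ∨ ∃ z : ℕ × ℕ, z ∈ x.2 ∧
    ((z.1 = 0 ∧ y.1 = 1 ∧ y.2 = []) ∨
      (∃ e, z.1 = 3 * 5 ^ e ∧ Below z.2.unpair.1 (3 * 5 ^ e) ∧ y.1 = 1 ∧ y.2 = []) ∨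
      ∃ b, ∃ τ : List Bool, b ≠ 0 ∧ z.1 = 2 ^ b ∧ Nat.pair z.2 (encode τ) ∈ W z.2 ∧
        Admissible y.1 y.2 ∧ Below y.1 (level b) ∧ DecidesSeg y.2 b τ)

theorem SigmaOne.child {α : Type*} [Primcodable α] {f g : α → ℕ × List (ℕ × ℕ)}
    (hf : Primrec f) (hg : Primrec g) : SigmaOne fun x => Child (f x) (g x) := by
  refine .or (.and (.eq ?_ ?_) (.eq ?_ ?_)) (.exists' (.and (.mem ?_ ?_) (.or
    (.and (.eq ?_ ?_) (.and (.eq ?_ ?_) (.eq ?_ ?_))) (.or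
    (.exists' (.and (.eq ?_ ?_) (.and (.below ?_ ?_) (.and (.eq ?_ ?_) (.eq ?_ ?_)))))
    (.exists' (.exists' (.and (.ne ?_ ?_) (.and (.eq ?_ ?_) (.and (.mem_W ?_ ?_)
      (.and (.admissible ?_ ?_) (.and (.below ?_ ?_) (.decidesSeg ?_ ?_ ?_))))))))))))
  all_goals fun_prop

/-- Levels drop strictly from parent to child, as the syntax of formulas and induction along `<_𝒪`
both require. -/
theorem Child.below_and_admissible {l : ℕ} {c : List (ℕ × ℕ)} {z : ℕ × List (ℕ × ℕ)}
    (h : Child (l, c) z) (hl : InO l) (hl' : l ≠ 1) (hc : Admissible l c) :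
    Below z.1 l ∧ Admissible z.1 z.2 := by
  obtain ⟨l', c'⟩ := z
  have h1 : Below 1 l := hl.one_belowEq.resolve_left hl'.symm
  rcases h with ⟨rfl, rfl⟩ | ⟨⟨a, m⟩, hz, ⟨-, rfl, rfl⟩ | ⟨e, -, -, rfl, rfl⟩ |
    ⟨b, τ, hb, rfl, -, ha, hlb, -⟩⟩
  · exact ⟨h1, fun x hx => .inl (by simp_all)⟩
  · exact ⟨h1, admissible_nil 1⟩
  · exact ⟨h1, admissible_nil 1⟩
  · refine ⟨?_, ha⟩
    rcases hc _ hz with h | ⟨b', hb', h, h'⟩ | ⟨e, h, -⟩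
    · exact ((pow_ne_zero b two_ne_zero) h).elim
    · obtain rfl := two_pow_inj h
      exact hlb.trans_le h'
    · exact (two_pow_ne_three_mul_five_pow _ _ h).elim

/-- An item `m ∉ H(2^b)` fails exactly when some computation accepts `m` on an initial segment of
`H(b)`. By `InO.exists_decidesSeg` that segment is settled by a true condition of level below `level
b`, which is a child; conversely, true children refute by soundness. The items that are outright
false or refuted by `Below` have the empty, true condition as a child. -/
theorem condTrue_iff_forall_child {l : ℕ} {c : List (ℕ × ℕ)} (hl : InO l)
    (hc : Admissible l c) :
    CondTrue c ↔ ∀ l' c', Child (l, c) (l', c') → ¬ CondTrue c' := by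
  constructor
  · rintro h l' c' (⟨rfl, rfl⟩ | ⟨⟨a, m⟩, hz, ⟨rfl, rfl, rfl⟩ | ⟨e, rfl, he, rfl, rfl⟩ |
      ⟨b, τ, hb, rfl, hW, -, -, hτ⟩⟩) h'
    · exact not_condTrue_zero h'
    · exact not_itemTrue_zero _ (h _ hz)
    · exact itemTrue_three_mul_five_pow.1 (h _ hz) he
    · have hbO : InO b := by
        rcases hc _ hz with h | ⟨b', hb', h, h'⟩ | ⟨e, h, -⟩
        · exact ((pow_ne_zero b two_ne_zero) h).elim
        · obtain rfl := two_pow_inj h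
          exact (hl.of_belowEq h').of_level hb
        · exact (two_pow_ne_three_mul_five_pow _ _ h).elim
      refine (itemTrue_two_pow hb).1 (h _ hz) ?_
      rw [hSet_two_pow hbO]
      exact ⟨τ, hτ.sound h' hbO, hW⟩
  · intro h x hx
    obtain ⟨a, m⟩ := x
    by_contra hn
    rcases hc _ hx with rfl | ⟨b, hb, rfl, h'⟩ | ⟨e, rfl, -⟩
    · exact h 1 [] (.inr ⟨_, hx, .inl ⟨rfl, rfl, rfl⟩⟩) condTrue_nil
    · have hbO := (hl.of_belowEq h').of_level hb
      rw [itemTrue_two_pow hb, not_not, hSet_two_pow hbO] at hn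
      obtain ⟨τ, hτ, hW⟩ := hn
      obtain ⟨l', c', hl', hac, hct, hd⟩ := hbO.exists_decidesSeg hτ
      exact h l' c' (.inr ⟨_, hx, .inr (.inr ⟨b, τ, hb, rfl, hW, hac, hl', hd⟩)⟩) hct
    · rw [itemTrue_three_mul_five_pow, not_not] at hn
      exact h 1 [] (.inr ⟨_, hx, .inr (.inl ⟨e, rfl, hn, rfl, rfl⟩)⟩) condTrue_nil

/-! ### Codes of formulas attached to conditions -/

/-- `true` and `false` stand for the kinds `Π` and `Σ`. -/
def kindOf (s : Bool) : Kind := bif s then .pi else .sigma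

@[fun_prop]
theorem primrec_mkCode {α : Type*} [Primcodable α] {s : α → Bool} {a e : α → ℕ}
    {xs : α → List ℕ} (hs : Primrec s) (ha : Primrec a) (hxs : Primrec xs) (he : Primrec e) :
    Primrec fun z => mkCode (kindOf (s z)) (a z) (xs z) (e z) := by
  have h : Primrec fun z => (kindOf (s z)).toNat :=
    (Primrec.dom_finite fun b => (kindOf b).toNat).comp hs
  unfold mkCode
  fun_prop

/-- Choice between `x` and `y` according to the kind `s` and the truth of `p`. -/
noncomputable def pick {α : Type*} (s : Bool) (p : Prop) (x y : α) : α :=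
  open Classical in if s = true ↔ p then x else y

/-- Parameters of a node formula: its kind, the codes of its two possible values, its level and
its condition. -/
abbrev Node := Bool × ℕ × ℕ × ℕ × List (ℕ × ℕ)

open Classical in
/-- The code of a node formula, given a program `C` that enumerates the codes of its children. -/
noncomputable def nodeCode (C : Code) (n : Node) : ℕ :=
  if n.2.2.2.1 = 1 then
    mkCode (kindOf n.1) 1 [0] (if n.1 = decide (n.2.2.2.2 = []) then n.2.1 else n.2.2.1)
  else mkCode (kindOf n.1) n.2.2.2.1 [] (encode (C.curry (encode n)))

theorem primrec_nodeCode : Primrec fun x : Code × Node => nodeCode x.1 x.2 := by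
  classical
  have h1 : PrimrecPred fun x : Code × Node => x.2.2.2.2.1 = 1 :=
    Primrec.eq.comp (by fun_prop) (by fun_prop)
  have h2 : PrimrecPred fun x : Code × Node => x.2.2.2.2.2 = [] :=
    Primrec.eq.comp (by fun_prop) (by fun_prop)
  have h3 : PrimrecPred fun x : Code × Node => x.2.1 = decide (x.2.2.2.2.2 = []) :=
    Primrec.eq.comp (by fun_prop) h2.decide
  have h4 : Primrec fun x : Code × Node =>
      if x.2.1 = decide (x.2.2.2.2.2 = []) then x.2.2.1 else x.2.2.2.1 :=
    Primrec.ite h3 (by fun_prop) (by fun_prop)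
  exact Primrec.ite h1 (by fun_prop) (by fun_prop)

/-- `g` computes codes of the formulas attached to conditions. -/
structure IsNodeCoding (g : Node → ℕ) : Prop where
  primrec : Primrec g
  leaf : ∀ s x y c, g (s, x, y, 1, c) = mkCode (kindOf s) 1 [0] (pick s (c = []) x y)
  node : ∀ s x y l c, l ≠ 1 → ∃ e, g (s, x, y, l, c) = mkCode (kindOf s) l [] e ∧
    ∀ k, k ∈ W e ↔ ∃ z : ℕ × List (ℕ × ℕ), Child (l, c) z ∧
      k = Nat.pair (encode [0, encode z]) (g (!s, x, y, z))

/-- The code of a node contains an index for the c.e. set of its children's codes, which is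
circular. The recursion theorem provides a single program `C` that knows itself; currying with the
node's parameters gives the index, so the coding is total and primitive recursive even when `l` is
no notation. -/
theorem exists_isNodeCoding : ∃ g, IsNodeCoding g := by
  classical
  let p : Code × ℕ → Prop := fun x => ∃ n : Node, ∃ z : ℕ × List (ℕ × ℕ),
    Child (n.2.2.2.1, n.2.2.2.2) z ∧ x.2 = Nat.pair (encode n)
      (Nat.pair (encode [0, encode z]) (nodeCode x.1 (!n.1, n.2.1, n.2.2.1, z)))
  have hp : SigmaOne p := by
    have hn : Primrec fun x : ((Code × ℕ) × Node) × ℕ × List (ℕ × ℕ) =>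
        nodeCode x.1.1.1 (!x.1.2.1, x.1.2.2.1, x.1.2.2.2.1, x.2) :=
      Primrec.comp (f := fun x : Code × Node => nodeCode x.1 x.2)
        (g := fun x : ((Code × ℕ) × Node) × ℕ × List (ℕ × ℕ) =>
          (x.1.1.1, !x.1.2.1, x.1.2.2.1, x.1.2.2.2.1, x.2)) primrec_nodeCode (by fun_prop)
    refine .exists' (.exists' (.and (.child ?_ ?_) (.eq ?_ ?_))) <;> fun_prop
  obtain ⟨C, hC⟩ := hp.fixed_point
  refine ⟨nodeCode C, ?_, ?_, ?_⟩
  · exact primrec_nodeCode.comp ((Primrec.const C).pair Primrec.id)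
  · intro s x y c
    by_cases hc : c = [] <;> cases s <;> simp [nodeCode, pick, hc]
  · intro s x y l c hl
    refine ⟨_, by rw [nodeCode, if_neg hl], fun k => ?_⟩
    simp only [W, phi, Denumerable.ofNat_encode, Code.eval_curry]
    refine (hC _).trans ⟨?_, ?_⟩
    · rintro ⟨n, z, h, h'⟩
      obtain ⟨h1, h2⟩ := Nat.pair_eq_pair.1 h'
      obtain rfl := encode_injective h1
      exact ⟨z, h, h2⟩
    · rintro ⟨z, h, rfl⟩
      exact ⟨(s, x, y, l, c), z, h, rfl⟩

/-! ### Formulas with constant value -/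

/-- `φ` takes the value `X` in every structure and under every assignment. -/
def HasValue (φ : Formula) (X : unitInterval) : Prop :=
  ∀ (M : Type u) [MetricSpace M] [Nonempty M] (hM : ∀ x y : M, dist x y ≤ 1) (v : ℕ → M),
    φ.eval hM v = X

/-- `j` is a code of a formula of kind `s` and level `b` with constant value `X` whose only free
variable is `x_0`. -/
def CodesValue (s : Kind) (b j : ℕ) (X : unitInterval) : Prop :=
  ∃ ys φ, ys ⊆ [0] ∧ IsCode s b ys j φ ∧ φ.freeVars ⊆ {0} ∧ HasValue.{u} φ X

/-- Each disjunct binds two variables: `x_0`, to close the formula, and a variable numbered `encode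
z`, which serves as a tag. The tag makes the enumerated pair determine `z`, so the disjunction has
exactly one disjunct for each `z` in `P`. Quantifying a constant-valued formula over a nonempty
space does not change its value. -/
theorem exists_isCode_sigma {ζ : Type*} [Encodable ζ] {P : ζ → Prop} {b j : ζ → ℕ}
    {V : ζ → unitInterval} {a e : ℕ} (ha : InO a) (ha1 : a ≠ 1)
    (hW : ∀ k, k ∈ W e ↔ ∃ z, P z ∧ k = Nat.pair (encode [0, encode z]) (j z))
    (h : ∀ z, P z → Below (b z) a ∧ CodesValue.{u} .pi (b z) (j z) (V z)) :
    ∃ φ, IsCode .sigma a [] (mkCode .sigma a [] e) φ ∧ φ.freeVars = ∅ ∧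
      HasValue.{u} φ (⨅ z : {z // P z}, V z) := by
  choose z hP hk using fun k : W e => (hW k).1 k.2
  have hz : Function.Surjective fun k : W e => (⟨z k, hP k⟩ : {z // P z}) := by
    rintro ⟨y, hy⟩
    refine ⟨⟨_, (hW _).2 ⟨y, hy, rfl⟩⟩, Subtype.ext ?_⟩
    have h1 := encode_injective (Nat.pair_eq_pair.1 (hk ⟨_, (hW _).2 ⟨y, hy, rfl⟩⟩)).1
    simp only [List.cons.injEq, true_and, and_true] at h1
    exact (encode_injective h1).symm
  choose hb ys ψ hys hψ hfv hV using fun k : W e => h (z k) (hP k)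
  refine ⟨_, .sigma a [] e (fun k => [0, encode (z k)]) (fun k => j (z k)) (fun k => b (z k)) ys ψ
    ha ha1 hk (fun k => ltO_iff.2 ⟨ha, hb k⟩)
    (fun k => List.Subset.trans (hys k) (by simp)) hψ, ?_, fun M _ _ hM v => ?_⟩
  · simp only [Formula.freeVars, Formula.infs, List.foldr_cons, List.foldr_nil,
      Set.iUnion_eq_empty, Set.sdiff_eq_empty]
    exact fun k => Set.sdiff_subset.trans (hfv k)
  · simp only [Formula.eval, Formula.infs, List.foldr_cons, List.foldr_nil, hV _ M hM, ciInf_const]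
    exact hz.iInf_comp fun z : {z // P z} => V z

theorem exists_isCode_pi {ζ : Type*} [Encodable ζ] {P : ζ → Prop} {b j : ζ → ℕ}
    {V : ζ → unitInterval} {a e : ℕ} (ha : InO a) (ha1 : a ≠ 1)
    (hW : ∀ k, k ∈ W e ↔ ∃ z, P z ∧ k = Nat.pair (encode [0, encode z]) (j z))
    (h : ∀ z, P z → Below (b z) a ∧ CodesValue.{u} .sigma (b z) (j z) (V z)) :
    ∃ φ, IsCode .pi a [] (mkCode .pi a [] e) φ ∧ φ.freeVars = ∅ ∧
      HasValue.{u} φ (⨆ z : {z // P z}, V z) := by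
  choose z hP hk using fun k : W e => (hW k).1 k.2
  have hz : Function.Surjective fun k : W e => (⟨z k, hP k⟩ : {z // P z}) := by
    rintro ⟨y, hy⟩
    refine ⟨⟨_, (hW _).2 ⟨y, hy, rfl⟩⟩, Subtype.ext ?_⟩
    have h1 := encode_injective (Nat.pair_eq_pair.1 (hk ⟨_, (hW _).2 ⟨y, hy, rfl⟩⟩)).1
    simp only [List.cons.injEq, true_and, and_true] at h1
    exact (encode_injective h1).symm
  choose hb ys ψ hys hψ hfv hV using fun k : W e => h (z k) (hP k)
  refine ⟨_, .pi a [] e (fun k => [0, encode (z k)]) (fun k => j (z k)) (fun k => b (z k)) ys ψ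
    ha ha1 hk (fun k => ltO_iff.2 ⟨ha, hb k⟩)
    (fun k => List.Subset.trans (hys k) (by simp)) hψ, ?_, fun M _ _ hM v => ?_⟩
  · simp only [Formula.freeVars, Formula.sups, List.foldr_cons, List.foldr_nil,
      Set.iUnion_eq_empty, Set.sdiff_eq_empty]
    exact fun k => Set.sdiff_subset.trans (hfv k)
  · simp only [Formula.eval, Formula.sups, List.foldr_cons, List.foldr_nil, hV _ M hM, ciSup_const]
    exact hz.iSup_comp fun z : {z // P z} => V z

/-- `x` is a Gödel number of a quantifier-free formula with constant value `X` whose only free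
variable is `x_0`. -/
def IsConstCode (x : ℕ) (X : unitInterval) : Prop :=
  ∃ φ, IsQFCode x φ ∧ φ.freeVars ⊆ {0} ∧ HasValue.{u} φ X

/-- A `Π` node is `X` when its condition is true and `Y` when false; a `Σ` node is the reverse. If
the condition is true, all children are false and share the desired value. If it is false, a true
child attains the extremum, because `X ≤ Y`. -/
theorem IsNodeCoding.codesValue {g : Node → ℕ} (hg : IsNodeCoding g) {x y : ℕ}
    {X Y : unitInterval} (hx : IsConstCode.{u} x X) (hy : IsConstCode.{u} y Y) (hXY : X ≤ Y)
    {l : ℕ} (hl : InO l) (s : Bool) {c : List (ℕ × ℕ)} (hc : Admissible l c) :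
    CodesValue.{u} (kindOf s) l (g (s, x, y, l, c)) (pick s (CondTrue c) X Y) := by
  classical
  revert s c
  refine hl.strong_rec_on fun l hl ih => ?_
  intro s c hc
  by_cases h1 : l = 1
  · subst h1
    have hcc : CondTrue c ↔ c = [] := by
      constructor
      · intro h
        refine List.eq_nil_iff_forall_not_mem.2 fun z hz => ?_
        obtain ⟨a, m⟩ := z
        obtain rfl : a = 0 := hc.fst_eq_zero _ hz
        exact not_itemTrue_zero m (h _ hz)
      · rintro rfl
        exact condTrue_nil
    obtain ⟨φ, hφ, hfv, hV⟩ :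
        IsConstCode.{u} (pick s (c = []) x y) (pick s (CondTrue c) X Y) := by
      rw [hcc]
      unfold pick
      split_ifs
      exacts [hx, hy]
    refine ⟨[0], φ, List.Subset.refl _, ?_, hfv, hV⟩
    rw [hg.leaf]
    exact .qf _ _ _ _ hφ (by simpa using hfv)
  · obtain ⟨e, he, hW⟩ := hg.node s x y l c h1
    have hchild := condTrue_iff_forall_child hl hc
    -- The false child `(1, [(0, 0)])` is always present. It prevents an empty disjunction or
    -- conjunction, whose value would be `1` or `0` instead of `Y` or `X`.
    have hne : Nonempty {z // Child (l, c) z} := ⟨⟨(1, [(0, 0)]), .inl ⟨rfl, rfl⟩⟩⟩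
    have hnot : CondTrue c → ∀ z : {z // Child (l, c) z}, ¬ CondTrue z.1.2 :=
      fun h z => hchild.1 h _ _ z.2
    have hex : ¬ CondTrue c → ∃ z : {z // Child (l, c) z}, CondTrue z.1.2 := by
      intro h
      rw [hchild] at h
      push Not at h
      obtain ⟨l', c', h₁, h₂⟩ := h
      exact ⟨⟨(l', c'), h₁⟩, h₂⟩
    have hsub : ∀ z, Child (l, c) z → Below z.1 l ∧ CodesValue.{u} (kindOf !s) z.1
        (g (!s, x, y, z)) (pick (!s) (CondTrue z.2) X Y) := fun z hz =>
      have h := hz.below_and_admissible hl h1 hc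
      ⟨h.1, ih _ h.1 _ h.2⟩
    rw [he]
    cases s with
    | false =>
      obtain ⟨φ, hφ, hfv, hV⟩ := exists_isCode_sigma hl h1 hW hsub
      refine ⟨[], φ, by simp, hφ, by simp [hfv], ?_⟩
      convert hV
      by_cases h : CondTrue c
      · simp [pick, h, hnot h]
      · obtain ⟨z, hz⟩ := hex h
        have : pick false (CondTrue c) X Y = X := by simp [pick, h]
        rw [this]
        refine le_antisymm (le_iInf fun z => ?_) (iInf_le_of_le z (by simp [pick, hz]))
        unfold pick
        split_ifs
        exacts [le_rfl, hXY]
    | true =>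
      obtain ⟨φ, hφ, hfv, hV⟩ := exists_isCode_pi hl h1 hW hsub
      refine ⟨[], φ, by simp, hφ, by simp [hfv], ?_⟩
      convert hV
      by_cases h : CondTrue c
      · simp [pick, h, hnot h]
      · obtain ⟨z, hz⟩ := hex h
        have : pick true (CondTrue c) X Y = Y := by simp [pick, h]
        rw [this]
        refine le_antisymm (le_iSup_of_le z (by simp [pick, hz])) (iSup_le fun z => ?_)
        unfold pick
        split_ifs
        exacts [hXY, le_rfl]

/-! ### Dyadic rationals -/

/-- Numerator and denominator of the dyadic rational with binary digits `D`. -/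
def dyadic (D : List Bool) : ℕ × ℕ :=
  D.foldr (fun d x => ((bif d then x.2 else 0) + x.1, 2 * x.2)) (0, 1)

/-- The value of the dyadic rational with binary digits `D`. -/
noncomputable def dyadicVal (D : List Bool) : ℝ := (dyadic D).1 / (dyadic D).2

/-- A Gödel number of a quantifier-free formula whose value is the dyadic rational with binary
digits `D`. -/
def dyadicCode (D : List Bool) : ℕ :=
  D.foldr (fun d x => bif d then 4 * (4 * (4 * x + 1) + 2) + 1 else 4 * x + 2) 0

theorem primrec_dyadic : Primrec dyadic := by
  refine Primrec.list_foldr (h := fun _ x => ((bif x.1 then x.2.2 else 0) + x.2.1, 2 * x.2.2))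
    Primrec.id (Primrec.const (0, 1)) ?_
  have : Primrec fun x : List Bool × Bool × ℕ × ℕ => bif x.2.1 then x.2.2.2 else 0 :=
    Primrec.cond (by fun_prop) (by fun_prop) (by fun_prop)
  exact show Primrec fun x : List Bool × Bool × ℕ × ℕ =>
    ((bif x.2.1 then x.2.2.2 else 0) + x.2.2.1, 2 * x.2.2.2) by fun_prop

theorem primrec_dyadicCode : Primrec dyadicCode := by
  refine Primrec.list_foldr
    (h := fun _ x => bif x.1 then 4 * (4 * (4 * x.2 + 1) + 2) + 1 else 4 * x.2 + 2)
    Primrec.id (Primrec.const 0) ?_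
  exact Primrec.cond (f := fun x : List Bool × Bool × ℕ => 4 * (4 * (4 * x.2.2 + 1) + 2) + 1)
    (g := fun x => 4 * x.2.2 + 2) (c := fun x => x.2.1) (by fun_prop) (by fun_prop) (by fun_prop)

attribute [fun_prop] primrec_dyadic primrec_dyadicCode

theorem dyadic_snd_pos (D : List Bool) : 0 < (dyadic D).2 := by
  induction D with
  | nil => simp [dyadic]
  | cons d D ih => exact Nat.mul_pos two_pos ih

theorem dyadicVal_nil : dyadicVal [] = 0 := by simp [dyadicVal, dyadic]

theorem dyadicVal_cons (d : Bool) (D : List Bool) :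
    dyadicVal (d :: D) = ((bif d then 1 else 0) + dyadicVal D) / 2 := by
  have h : ((dyadic D).2 : ℝ) ≠ 0 := by exact_mod_cast (dyadic_snd_pos D).ne'
  have h1 : dyadic (d :: D) = ((bif d then (dyadic D).2 else 0) + (dyadic D).1, 2 * (dyadic D).2) :=
    rfl
  unfold dyadicVal
  rw [h1]
  cases d
  · simp only [cond_false]
    push_cast
    field_simp
    ring
  · simp only [cond_true]
    push_cast
    field_simp

theorem dyadicVal_mem (D : List Bool) : dyadicVal D ∈ Set.Icc (0 : ℝ) 1 := by
  induction D with
  | nil => simp [dyadicVal_nil]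
  | cons d D ih =>
    obtain ⟨h0, h1⟩ := ih
    rw [dyadicVal_cons]
    cases d <;> simp only [cond_false, cond_true] <;> constructor <;> linarith

/-- The first binary digit records whether `t` exceeds `1/2`; doubling `t` and removing that digit
leads to the next one. At `t = 1/2` the digit is `0`, which keeps the approximation strictly below
`t`. -/
theorem exists_dyadicVal_approx (j : ℕ) {t : ℝ} (h0 : 0 < t) (h1 : t ≤ 1) :
    ∃ D, dyadicVal D < t ∧ t ≤ dyadicVal D + (1 / 2) ^ j := by
  induction j generalizing t with
  | zero => exact ⟨[], by simpa [dyadicVal_nil] using h0, by simpa [dyadicVal_nil] using h1⟩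
  | succ j ih =>
    by_cases h : t ≤ 1 / 2
    · obtain ⟨D, hD, hD'⟩ := ih (t := 2 * t) (by linarith) (by linarith)
      refine ⟨false :: D, ?_, ?_⟩ <;> rw [dyadicVal_cons, cond_false]
      · linarith
      · rw [pow_succ]
        linarith
    · push Not at h
      obtain ⟨D, hD, hD'⟩ := ih (t := 2 * t - 1) (by linarith) (by linarith)
      refine ⟨true :: D, ?_, ?_⟩ <;> rw [dyadicVal_cons, cond_true]
      · linarith
      · rw [pow_succ]
        linarith

theorem exists_dyadicVal_between {s t : ℝ} (h0 : 0 ≤ s) (h : s < t) (h1 : t ≤ 1) :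
    ∃ D, s < dyadicVal D ∧ dyadicVal D < t := by
  obtain ⟨j, hj⟩ := exists_pow_lt_of_lt_one (sub_pos.2 h) (by norm_num : (1 / 2 : ℝ) < 1)
  obtain ⟨D, hD, hD'⟩ := exists_dyadicVal_approx j (h0.trans_lt h) h1
  exact ⟨D, by linarith, hD⟩

/-- The value of a dyadic rational as an element of the unit interval. -/
noncomputable def dyadicUnit (D : List Bool) : unitInterval := ⟨dyadicVal D, dyadicVal_mem D⟩

theorem IsConstCode.zero : IsConstCode.{u} 0 0 := by
  refine ⟨.dist 0 0, .dist 0 0, by simp [Formula.freeVars], fun M _ _ hM v => ?_⟩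
  exact Subtype.ext (dist_self _)

theorem IsConstCode.neg {x : ℕ} {X : unitInterval} (h : IsConstCode.{u} x X) :
    IsConstCode.{u} (4 * x + 1) (unitInterval.symm X) := by
  obtain ⟨φ, hφ, hfv, hV⟩ := h
  exact ⟨φ.neg, .neg _ _ hφ, hfv, fun M _ _ hM v => by rw [Formula.eval, hV M hM]⟩

theorem IsConstCode.half {x : ℕ} {X Y : unitInterval} (h : IsConstCode.{u} x X)
    (hY : (Y : ℝ) = X / 2) : IsConstCode.{u} (4 * x + 2) Y := by
  obtain ⟨φ, hφ, hfv, hV⟩ := h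
  refine ⟨φ.half, .half _ _ hφ, hfv, fun M _ _ hM v => Subtype.ext ?_⟩
  simp only [Formula.eval, hV M hM, hY]

theorem IsConstCode.one : IsConstCode.{u} 1 1 := by
  simpa using IsConstCode.zero.neg

/-- Prefixing the digit `0` is `½x`, and prefixing `1` is `¬½¬x = (1 + x)/2`. -/
theorem isConstCode_dyadicCode (D : List Bool) :
    IsConstCode.{u} (dyadicCode D) (dyadicUnit D) := by
  induction D with
  | nil =>
    have : dyadicUnit [] = 0 := Subtype.ext dyadicVal_nil
    rw [this]
    exact .zero
  | cons d D ih =>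
    cases d with
    | false =>
      refine ih.half ?_
      simp [dyadicUnit, dyadicVal_cons]
    | true =>
      have h := (ih.neg.half (Y := unitInterval.symm (dyadicUnit (true :: D))) ?_).neg
      · rwa [unitInterval.symm_symm] at h
      · simp only [unitInterval.coe_symm_eq, dyadicUnit, dyadicVal_cons, cond_true]
        ring

/-! ### Comparison with the enumeration of the rationals -/

theorem ratEnum_surjective : Function.Surjective ratEnum := by
  intro q
  obtain ⟨x, y, hxy⟩ : ∃ x y : ℕ, (q.num : ℤ) = x - y :=
    ⟨q.num.toNat, (-q.num).toNat, (Int.toNat_sub_toNat_neg q.num).symm⟩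
  refine ⟨Nat.pair x (Nat.pair y (q.den - 1)), ?_⟩
  have hden : ((q.den - 1 : ℕ) : ℚ) + 1 = q.den := by
    rw [Nat.cast_sub q.pos]
    push_cast
    ring
  have hnum : (q.num : ℚ) = x - y := by exact_mod_cast congrArg (Int.cast : ℤ → ℚ) hxy
  simp only [ratEnum, Nat.unpair_pair]
  rw [hden, ← hnum, Rat.num_div_den]

/-- Cross-multiplying and moving the negative term across leaves an inequality of natural numbers,
visibly primitive recursive. -/
theorem ratEnum_le_dyadicVal_iff (n : ℕ) (D : List Bool) :
    (ratEnum n : ℝ) ≤ dyadicVal D ↔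
      n.unpair.1 * (dyadic D).2 ≤
        (dyadic D).1 * (n.unpair.2.unpair.2 + 1) + n.unpair.2.unpair.1 * (dyadic D).2 := by
  have h : (0 : ℝ) < (dyadic D).2 := by exact_mod_cast dyadic_snd_pos D
  have h' : (0 : ℝ) < (n.unpair.2.unpair.2 : ℝ) + 1 := by positivity
  rw [← Nat.cast_le (α := ℝ)]
  unfold dyadicVal ratEnum
  push_cast
  rw [div_le_div_iff₀ h' h, sub_mul, sub_le_iff_le_add]

theorem dyadicVal_le_ratEnum_iff (n : ℕ) (D : List Bool) :
    dyadicVal D ≤ (ratEnum n : ℝ) ↔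
      (dyadic D).1 * (n.unpair.2.unpair.2 + 1) + n.unpair.2.unpair.1 * (dyadic D).2 ≤
        n.unpair.1 * (dyadic D).2 := by
  have h : (0 : ℝ) < (dyadic D).2 := by exact_mod_cast dyadic_snd_pos D
  have h' : (0 : ℝ) < (n.unpair.2.unpair.2 : ℝ) + 1 := by positivity
  rw [← Nat.cast_le (α := ℝ)]
  unfold dyadicVal ratEnum
  push_cast
  rw [div_le_div_iff₀ h h', sub_mul, le_sub_iff_add_le]

/-! ### Numerals -/

/-- A dyadic rational together with a node. -/
abbrev Disjunct := List Bool × ℕ × List (ℕ × ℕ)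

/-- The node of `z` is a condition that yields `n ∈ W_i^{H(a)}`, where `e = ⟨i, a⟩`. -/
def Witnesses (e n : ℕ) (z : Disjunct) : Prop :=
  ∃ τ : List Bool, Nat.pair n (encode τ) ∈ W e.unpair.1 ∧ Admissible z.2.1 z.2.2 ∧
    Below z.2.1 (level e.unpair.2) ∧ DecidesSeg z.2.2 e.unpair.2 τ

theorem SigmaOne.witnesses {α : Type*} [Primcodable α] {e n : α → ℕ} {z : α → Disjunct}
    (he : Primrec e) (hn : Primrec n) (hz : Primrec z) :
    SigmaOne fun x => Witnesses (e x) (n x) (z x) := by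
  refine .exists' (.and (.mem_W ?_ ?_) (.and (.admissible ?_ ?_)
    (.and (.below ?_ ?_) (.decidesSeg ?_ ?_ ?_)))) <;> fun_prop

theorem Witnesses.sound {e n : ℕ} {z : Disjunct} (h : Witnesses e n z) (he : InO e.unpair.2)
    (hz : CondTrue z.2.2) : n ∈ WRel e.unpair.1 (hSet e.unpair.2) := by
  obtain ⟨τ, hW, -, -, hd⟩ := h
  exact ⟨τ, hd.sound hz he, hW⟩

theorem exists_witnesses {e n : ℕ} (he : InO e.unpair.2)
    (hn : n ∈ WRel e.unpair.1 (hSet e.unpair.2)) (D : List Bool) :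
    ∃ l c, Witnesses e n (D, l, c) ∧ CondTrue c := by
  obtain ⟨τ, hτ, hW⟩ := hn
  obtain ⟨l, c, hl, ha, hc, hd⟩ := he.exists_decidesSeg hτ
  exact ⟨l, c, ⟨τ, hW, ha, hl, hd⟩, hc⟩

theorem isNumeral_of_hasValue {φ : Formula} {X : unitInterval} (h : φ.freeVars = ∅)
    (hV : HasValue.{u} φ X) : Formula.IsNumeral.{u} φ X :=
  ⟨h, fun M _ _ hM v => by rw [hV M hM v]⟩

theorem IsSigmaIndex.spec {α : Ordinal.{0}} {e : ℕ} {A : Set ℕ} (h : IsSigmaIndex α e A) :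
    InO e.unpair.2 ∧ Denotes (level e.unpair.2) α ∧ A = WRel e.unpair.1 (hSet e.unpair.2) := by
  obtain ⟨β, X, ⟨P, hP⟩, rfl, hX, rfl⟩ := h
  exact ⟨⟨β, P, hP⟩, hP.denotes_level, by rw [hX.eq_hSet]⟩

/-- A disjunct is a dyadic `D`, some `q_n ≤ D` and a condition that would put `n` in the cut. It is
worth `D` if the condition is true and `1` otherwise, so false conditions cannot lower the infimum.
-/
theorem exists_sigma_numeral : ∃ f : ℕ → ℕ, Computable f ∧
    ∀ (α : Ordinal.{0}) (r : ℝ), r ∈ Set.Icc (0 : ℝ) 1 →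
      ∀ e, IsSigmaIndex α e (rightCut r) →
        ∃ Φ, IsSigmaCode α (f e) Φ ∧ Formula.IsNumeral.{u} Φ r := by
  obtain ⟨g, hg⟩ := exists_isNodeCoding
  have hgp := hg.primrec
  let P : ℕ → Disjunct → Prop := fun e z => ∃ n, (ratEnum n : ℝ) ≤ dyadicVal z.1 ∧ Witnesses e n z
  let j : Disjunct → ℕ := fun z => g (true, dyadicCode z.1, 1, z.2)
  have hp : SigmaOne fun x : ℕ × ℕ =>
      ∃ z, P x.1 z ∧ x.2 = Nat.pair (encode [0, encode z]) (j z) := by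
    simp only [P, ratEnum_le_dyadicVal_iff]
    refine .exists' (.and (.exists' (.and (.le ?_ ?_) (.witnesses ?_ ?_ ?_))) (.eq ?_ ?_))
    all_goals fun_prop
  obtain ⟨i, hi, hW⟩ := hp.exists_index
  refine ⟨fun e => mkCode (kindOf false) (level e.unpair.2) [] (i e),
    Primrec.to_comp (by fun_prop), fun α r hr e he => ?_⟩
  obtain ⟨hO, hα, hA⟩ := he.spec
  obtain ⟨φ, hφ, hfv, hV⟩ := exists_isCode_sigma.{u} hO.level (level_ne_one hO.ne_zero)
    (P := P e) (j := j) (b := fun z => z.2.1)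
    (V := fun z => pick true (CondTrue z.2.2) (dyadicUnit z.1) 1) (hW e) (by
      rintro z ⟨n, -, τ, -, ha, hl, -⟩
      exact ⟨hl, hg.codesValue (isConstCode_dyadicCode z.1) .one unitInterval.le_one'
        (hO.level.of_below hl) true ha⟩)
  refine ⟨φ, ⟨_, [], hα, hφ⟩, ?_⟩
  convert isNumeral_of_hasValue hfv hV
  change ((⟨r, hr⟩ : unitInterval) : ℝ) = _
  refine congrArg _ (le_antisymm (le_iInf ?_) (le_of_not_gt fun hlt => ?_))
  · rintro ⟨z, n, hn, hw⟩
    unfold pick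
    split_ifs with h
    · have hm : n ∈ rightCut r := hA ▸ hw.sound hO (h.1 rfl)
      exact show r ≤ dyadicVal z.1 from (le_of_lt hm).trans hn
    · exact unitInterval.le_one'
  · set I := ⨅ z : {z // P e z}, pick true (CondTrue z.1.2.2) (dyadicUnit z.1.1) 1
    -- With `r < q_n < D < I`, a true condition witnessing that `n` is in the cut gives a disjunct
    -- of value `D`, below the infimum `I`.
    obtain ⟨D, hD, hD'⟩ := exists_dyadicVal_between hr.1 (show r < (I : ℝ) from hlt) I.2.2
    obtain ⟨q, hq, hq'⟩ := exists_rat_btwn hD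
    obtain ⟨n, rfl⟩ := ratEnum_surjective q
    obtain ⟨l, c, hw, hc⟩ := exists_witnesses hO (hA ▸ (show n ∈ rightCut r from hq)) D
    have : I ≤ dyadicUnit D :=
      (iInf_le _ (⟨(D, l, c), n, hq'.le, hw⟩ : {z // P e z})).trans (by simp [pick, hc])
    exact absurd hD' (not_lt.2 this)

/-- Dual to the case of right cuts: conjuncts are `Σ` nodes worth `D ≤ q_n` if the condition is true
and `0` otherwise. -/
theorem exists_pi_numeral : ∃ f : ℕ → ℕ, Computable f ∧
    ∀ (α : Ordinal.{0}) (r : ℝ), r ∈ Set.Icc (0 : ℝ) 1 →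
      ∀ e, IsSigmaIndex α e (leftCut r) →
        ∃ Φ, IsPiCode α (f e) Φ ∧ Formula.IsNumeral.{u} Φ r := by
  obtain ⟨g, hg⟩ := exists_isNodeCoding
  have hgp := hg.primrec
  let P : ℕ → Disjunct → Prop := fun e z => ∃ n, dyadicVal z.1 ≤ (ratEnum n : ℝ) ∧ Witnesses e n z
  let j : Disjunct → ℕ := fun z => g (false, 0, dyadicCode z.1, z.2)
  have hp : SigmaOne fun x : ℕ × ℕ =>
      ∃ z, P x.1 z ∧ x.2 = Nat.pair (encode [0, encode z]) (j z) := by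
    simp only [P, dyadicVal_le_ratEnum_iff]
    refine .exists' (.and (.exists' (.and (.le ?_ ?_) (.witnesses ?_ ?_ ?_))) (.eq ?_ ?_))
    all_goals fun_prop
  obtain ⟨i, hi, hW⟩ := hp.exists_index
  refine ⟨fun e => mkCode (kindOf true) (level e.unpair.2) [] (i e),
    Primrec.to_comp (by fun_prop), fun α r hr e he => ?_⟩
  obtain ⟨hO, hα, hA⟩ := he.spec
  obtain ⟨φ, hφ, hfv, hV⟩ := exists_isCode_pi.{u} hO.level (level_ne_one hO.ne_zero)
    (P := P e) (j := j) (b := fun z => z.2.1)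
    (V := fun z => pick false (CondTrue z.2.2) 0 (dyadicUnit z.1)) (hW e) (by
      rintro z ⟨n, -, τ, -, ha, hl, -⟩
      exact ⟨hl, hg.codesValue .zero (isConstCode_dyadicCode z.1) unitInterval.nonneg'
        (hO.level.of_below hl) false ha⟩)
  refine ⟨φ, ⟨_, [], hα, hφ⟩, ?_⟩
  convert isNumeral_of_hasValue hfv hV
  change ((⟨r, hr⟩ : unitInterval) : ℝ) = _
  refine congrArg _ (le_antisymm (le_of_not_gt fun hlt => ?_) (iSup_le ?_))
  · set I := ⨆ z : {z // P e z}, pick false (CondTrue z.1.2.2) 0 (dyadicUnit z.1.1)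
    obtain ⟨D, hD, hD'⟩ := exists_dyadicVal_between I.2.1 (show (I : ℝ) < r from hlt) hr.2
    obtain ⟨q, hq, hq'⟩ := exists_rat_btwn hD'
    obtain ⟨n, rfl⟩ := ratEnum_surjective q
    obtain ⟨l, c, hw, hc⟩ := exists_witnesses hO (hA ▸ (show n ∈ leftCut r from hq')) D
    have : dyadicUnit D ≤ I :=
      le_trans (by simp [pick, hc]) (le_iSup _ (⟨(D, l, c), n, hq.le, hw⟩ : {z // P e z}))
    exact absurd hD (not_lt.2 this)
  · rintro ⟨z, n, hn, hw⟩
    unfold pick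
    split_ifs with h
    · exact unitInterval.nonneg'
    · have hc : CondTrue z.2.2 := by
        by_contra hc
        exact h (iff_of_false Bool.false_ne_true hc)
      have hm : n ∈ leftCut r := hA ▸ hw.sound hO hc
      exact show dyadicVal z.1 ≤ r from hn.trans (le_of_lt hm)

end HypNum

/-! ### The main theorem -/

theorem theorem1 :
    -- right cuts
    ((∀ (α : Ordinal.{0}) (r : ℝ), 0 < α → α < HypNum.omega1CK → r ∈ Set.Icc (0 : ℝ) 1 →
        HypNum.IsSigmaSet α (HypNum.rightCut r) →
        ∃ Φ : HypNum.Formula,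
          HypNum.IsComputableSigma α Φ ∧ HypNum.Formula.IsNumeral.{u} Φ r) ∧
      -- one computable function works for all `α`, `r` and all indices of the cut
      (∃ f : ℕ → ℕ, Computable f ∧
        ∀ (α : Ordinal.{0}) (r : ℝ), 0 < α → α < HypNum.omega1CK → r ∈ Set.Icc (0 : ℝ) 1 →
          ∀ e : ℕ, HypNum.IsSigmaIndex α e (HypNum.rightCut r) →
            ∃ Φ : HypNum.Formula,
              HypNum.IsSigmaCode α (f e) Φ ∧ HypNum.Formula.IsNumeral.{u} Φ r)) ∧
    -- left cuts
    ((∀ (α : Ordinal.{0}) (r : ℝ), 0 < α → α < HypNum.omega1CK → r ∈ Set.Icc (0 : ℝ) 1 →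
        HypNum.IsSigmaSet α (HypNum.leftCut r) →
        ∃ Φ : HypNum.Formula,
          HypNum.IsComputablePi α Φ ∧ HypNum.Formula.IsNumeral.{u} Φ r) ∧
      (∃ f : ℕ → ℕ, Computable f ∧
        ∀ (α : Ordinal.{0}) (r : ℝ), 0 < α → α < HypNum.omega1CK → r ∈ Set.Icc (0 : ℝ) 1 →
          ∀ e : ℕ, HypNum.IsSigmaIndex α e (HypNum.leftCut r) →
            ∃ Φ : HypNum.Formula,
              HypNum.IsPiCode α (f e) Φ ∧ HypNum.Formula.IsNumeral.{u} Φ r)) := by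
  obtain ⟨f, hf, hf'⟩ := HypNum.exists_sigma_numeral.{u}
  obtain ⟨g, hg, hg'⟩ := HypNum.exists_pi_numeral.{u}
  refine ⟨⟨fun α r _ _ hr ⟨e, he⟩ => ?_, f, hf, fun α r _ _ hr => hf' α r hr⟩,
    fun α r _ _ hr ⟨e, he⟩ => ?_, g, hg, fun α r _ _ hr => hg' α r hr⟩
  · obtain ⟨Φ, hΦ, h⟩ := hf' α r hr e he
    exact ⟨Φ, ⟨_, hΦ⟩, h⟩
  · obtain ⟨Φ, hΦ, h⟩ := hg' α r hr e he
    exact ⟨Φ, ⟨_, hΦ⟩, h⟩
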